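/- **Setting.** A seller offers products over periods $t=1,2,\dots$. A product has a raw feature vector $\tilde x\in\mathbb R^{\tilde d}$ and mapped features $x=\phi(\tilde x)\in\mathbb R^d$, with $\phi$ measurable. In period $t$ the customer has a nonempty consideration set $\mathcal C_t$ of at most $N$ products. If product $i$ has price $p_{it}$, then with $u^0_{it}(\nu)=\langle x_i,\theta\rangle-\langle x_i,\gamma\rangle p_{it}$ for $\nu=(\theta,\gamma)\in\mathbb R^{2d}$ and $u^0_{\emptyset t}(\nu)=0$ for no purchase, the utilities are $u_{it}=\psi(u^0_{it}(\nu_0)+z_{it})$, $i\in\mathcal C_t\cup\{\emptyset\}$, where $\psi$ is strictly increasing and $\nu_0=(\theta_0,\gamma_0)$ is the true parameter. The customer chooses $i_t\in\arg\max_{i\in\mathcal C_t\cup\{\emptyset\}}u_{it}$ (ties broken in any way). Episode $j=1,2,\dots$ consists of $j+d$ consecutive periods, the first $d$ of which are exploration periods; $I_k$ is the set of the $kd$ exploration periods in episodes $1,\dots,k$. In the periods $t\in I_k$, the feature vectors $\tilde x$ of the products are i.i.d. with law $\mathcal D$, the prices are i.i.d. uniform on $[0,1]$, the shocks $z_{it}$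 (including $z_{\emptyset t}$) are i.i.d. Gumbel with scale one and a common location, and the features, the prices, the shocks and the family of consideration sets $(\mathcal C_t)_{t\in I_k}$ are mutually independent. Assume, for constants $W$, $L_0>0$, $c_{\min}>0$: $\|\theta_0\|_1+\|\gamma_0\|_1\le W$; and, for $\tilde x\sim\mathcal D$ and $x=\phi(\tilde x)$, almost surely $\|x\|_\infty\le1$ and $\langle x,\gamma_0\rangle\ge L_0$; and the smallest eigenvalue of $\Sigma=\mathbb E[xx^{\mathsf T}]$ is at least $c_{\min}$. Let $$\mathcal L_k(\nu)=-\frac1{kd}\sum_{t\in I_k}\log\frac{\exp(u^0_{i_tt}(\nu))}{\sum_{\ell\in\mathcal C_t\cup\{\emptyset\}}\exp(u^0_{\ell t}(\nu))},\qquad \widehat\nu^k=(\widehat\theta^k,\widehat\gamma^k)\in\arg\min_{\|\nu\|_1\le W}\mathcal L_k(\nu).$$ **Proposition.** There are constants $c_0,c_1,c_2>0$, depending only on $W,L_0,N,c_{\min}$, such that for all $d$ and all $k\ge c_0d$, with probability at least $1-d^{-2}k^{-1.5}-2e^{-c_2kd}$, every such minimizer satisfies $$\|\widehat\theta^k-\theta_0\|^2+\|\widehat\gamma^k-\gamma_0\|^2\le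 c_1\,\frac{\log(kd)}{k},$$ where $\|\cdot\|$ is the Euclidean norm. -/

import Mathlib

open MeasureTheory ProbabilityTheory

namespace MNLPricing

noncomputable section

/-- Column vectors in `ℝⁿ` with the Euclidean norm. -/
abbrev Vec (n : ℕ) : Type := EuclideanSpace ℝ (Fin n)

/-- Parameters `ν = (θ, γ)` of the demand curve, with `θ, γ ∈ ℝᵈ`. -/
abbrev Param (d : ℕ) : Type := Vec d × Vec d

/-- The `ℓ₁` norm of the stacked vector `ν = (θ, γ) ∈ ℝ²ᵈ`. -/
def l1Norm {d : ℕ} (ν : Param d) : ℝ := ∑ j, |ν.1 j| + ∑ j, |ν.2 j|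

/-- The Gumbel law with location `m` (and scale one): its cumulative distribution function is
`y ↦ exp (-exp (-(y - m)))`.  Location `0` is the standard law, and location minus the
Euler-Mascheroni constant gives the centred one. -/
def gumbelMeasure (m : ℝ) : Measure ℝ :=
  volume.withDensity fun y => ENNReal.ofReal (Real.exp (-(y - m) - Real.exp (-(y - m))))

/-! ### The episodes -/

/-- First period of episode `j = 1, 2, …`; periods are numbered from `1`, and episode `i` consists
of `i + d` consecutive periods. -/
def episodeStart (d j : ℕ) : ℕ := 1 + ∑ i ∈ Finset.Ico 1 j, (i + d)

/-- The exploration periods up to episode `k`: the initial `d` periods of each of the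
episodes `1, …, k`. -/
def explorationPeriods (d k : ℕ) : Finset ℕ :=
  (Finset.Icc 1 k).biUnion fun j => Finset.Ico (episodeStart d j) (episodeStart d j + d)

theorem episodeStart_add_le (d : ℕ) {i j : ℕ} (hi : 1 ≤ i) (hij : i < j) :
    episodeStart d i + d ≤ episodeStart d j := by
  have h : ∑ l ∈ Finset.Ico 1 (i + 1), (l + d) ≤ ∑ l ∈ Finset.Ico 1 j, (l + d) :=
    Finset.sum_le_sum_of_subset (Finset.Ico_subset_Ico le_rfl hij)
  rw [Finset.sum_Ico_succ_top hi] at h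
  unfold episodeStart
  omega

/-- There are `k d` exploration periods up to episode `k`. -/
theorem card_explorationPeriods (d k : ℕ) : (explorationPeriods d k).card = k * d := by
  unfold explorationPeriods
  rw [Finset.card_biUnion]
  · simp
  · intro i hi j hj hne
    rw [Finset.mem_coe, Finset.mem_Icc] at hi hj
    rw [Function.onFun, Finset.disjoint_left]
    intro t ht ht'
    rw [Finset.mem_Ico] at ht ht'
    rcases lt_or_gt_of_ne hne with h | h
    · have := episodeStart_add_le d hi.1 h
      omega
    · have := episodeStart_add_le d hj.1 h
      omega

/-! ### The market -/

/-- Second moment matrix `Σ = E[x xᵀ]` of the mapped feature `x = φ(x̃)`, `x̃ ∼ D`. -/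
def secondMoment {r d : ℕ} (φ : Vec r → Vec d) (D : Measure (Vec r)) : Matrix (Fin d) (Fin d) ℝ :=
  Matrix.of fun i j => ∫ x, φ x i * φ x j ∂D

/-- The standing assumptions on the feature map `φ`, the feature distribution `D` and the true
parameters `ν₀ = (θ₀, γ₀)`. -/
structure IsMarket (W L₀ cmin : ℝ) {r d : ℕ} (φ : Vec r → Vec d) (D : Measure (Vec r))
    (ν₀ : Param d) : Prop where
  isProbabilityMeasure : IsProbabilityMeasure D
  measurable_featureMap : Measurable φ
  /-- the mapped features satisfy `‖x‖_∞ ≤ 1` -/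
  feature_bound : ∀ᵐ x ∂D, ∀ j, |φ x j| ≤ 1
  param_bound : l1Norm ν₀ ≤ W
  /-- the price sensitivities are at least `L₀` -/
  sensitivity_bound : ∀ᵐ x ∂D, L₀ ≤ inner ℝ (φ x) ν₀.2
  /-- the smallest eigenvalue of `Σ` is at least `cmin` -/
  nondegenerate : ∀ v : Vec d, cmin * ‖v‖ ^ 2 ≤ v ⬝ᵥ (secondMoment φ D).mulVec v

/-! ### Sales data -/

/-- What happens in the periods `t`, as random objects on `Ω`.  The products are labelled by `ι`;
`none : Option ι` stands for the no-purchase option. -/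
structure SalesData (Ω ι : Type*) (r : ℕ) where
  /-- the feature vector of product `i` in period `t` -/
  feature : ℕ → ι → Ω → Vec r
  /-- the price of product `i` in period `t` -/
  price : ℕ → ι → Ω → ℝ
  /-- the market shock of product `i`, or of the no-purchase option, in period `t` -/
  shock : ℕ → Option ι → Ω → ℝ
  /-- the consideration set of period `t` -/
  consideration : ℕ → Ω → Finset ι
  /-- what the customer of period `t` chooses -/
  choice : ℕ → Ω → Option ι

namespace SalesData

variable {Ω ι : Type*} {r d : ℕ}

/-- Deterministic utility `u⁰ᵢₜ(ν) = ⟨xᵢ, θ⟩ - ⟨xᵢ, γ⟩ pᵢₜ`, and `0` for no purchase. -/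
def baseUtility (S : SalesData Ω ι r) (φ : Vec r → Vec d) (ν : Param d) (t : ℕ) (ω : Ω) :
    Option ι → ℝ
  | none => 0
  | some i =>
      inner ℝ (φ (S.feature t i ω)) ν.1 - inner ℝ (φ (S.feature t i ω)) ν.2 * S.price t i ω

/-- Utility `uᵢₜ = ψ(u⁰ᵢₜ(ν₀) + zᵢₜ)`. -/
def utility (S : SalesData Ω ι r) (ψ : ℝ → ℝ) (φ : Vec r → Vec d) (ν₀ : Param d) (t : ℕ) (ω : Ω)
    (o : Option ι) : ℝ :=
  ψ (S.baseUtility φ ν₀ t ω o + S.shock t o ω)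

/-- The options of the customer of period `t`: the products of the consideration set, and no
purchase. -/
def options (S : SalesData Ω ι r) (t : ℕ) (ω : Ω) : Finset (Option ι) :=
  Finset.insertNone (S.consideration t ω)

/-- Negative log-likelihood `L_k(ν)` of the choices in the exploration periods up to
episode `k`. -/
def loss (S : SalesData Ω ι r) (φ : Vec r → Vec d) (k : ℕ) (ω : Ω) (ν : Param d) : ℝ :=
  -(1 / ((k : ℝ) * d)) * ∑ t ∈ explorationPeriods d k,
    Real.log (Real.exp (S.baseUtility φ ν t ω (S.choice t ω)) /
      ∑ o ∈ S.options t ω, Real.exp (S.baseUtility φ ν t ω o))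

/-- `ν` is a constrained maximum-likelihood estimate: it minimizes `L_k` over `‖ν‖₁ ≤ W`. -/
def IsConstrainedMLE (S : SalesData Ω ι r) (φ : Vec r → Vec d) (W : ℝ) (k : ℕ) (ω : Ω)
    (ν : Param d) : Prop :=
  l1Norm ν ≤ W ∧ ∀ ν' : Param d, l1Norm ν' ≤ W → S.loss φ k ω ν ≤ S.loss φ k ω ν'

/-- The law of the sales data in the exploration periods up to episode `k`, under the true
parameters `ν₀`, with consideration sets of size at most `N`.  Nothing is asked of the other
periods. -/
structure IsExploration [MeasurableSpace Ω] (S : SalesData Ω ι r) (P : Measure Ω) (N : ℕ)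
    (m : ℝ) (ψ : ℝ → ℝ) (φ : Vec r → Vec d) (D : Measure (Vec r)) (ν₀ : Param d) (k : ℕ) :
    Prop where
  measurable_feature : ∀ t ∈ explorationPeriods d k, ∀ i, Measurable (S.feature t i)
  measurable_price : ∀ t ∈ explorationPeriods d k, ∀ i, Measurable (S.price t i)
  measurable_shock : ∀ t ∈ explorationPeriods d k, ∀ o, Measurable (S.shock t o)
  measurable_consideration : ∀ t ∈ explorationPeriods d k, Measurable (S.consideration t)
  consideration_nonempty : ∀ t ∈ explorationPeriods d k, ∀ ω, (S.consideration t ω).Nonempty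
  consideration_card : ∀ t ∈ explorationPeriods d k, ∀ ω, (S.consideration t ω).card ≤ N
  /-- features are sampled from `D` -/
  law_feature : ∀ t ∈ explorationPeriods d k, ∀ i, P.map (S.feature t i) = D
  /-- exploration prices are uniform on `[0, 1]` -/
  law_price : ∀ t ∈ explorationPeriods d k, ∀ i,
    P.map (S.price t i) = volume.restrict (Set.Icc (0 : ℝ) 1)
  /-- market shocks follow the Gumbel law -/
  law_shock : ∀ t ∈ explorationPeriods d k, ∀ o, P.map (S.shock t o) = gumbelMeasure m
  indep_features : iIndepFun
    (fun (s : explorationPeriods d k × ι) ω => S.feature s.1 s.2 ω) P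
  indep_prices : iIndepFun
    (fun (s : explorationPeriods d k × ι) ω => S.price s.1 s.2 ω) P
  indep_shocks : iIndepFun
    (fun (s : explorationPeriods d k × Option ι) ω => S.shock s.1 s.2 ω) P
  /-- the prices are independent of the shocks -/
  indep_price_shock : IndepFun
    (fun ω (s : explorationPeriods d k × ι) => S.price s.1 s.2 ω)
    (fun ω (s : explorationPeriods d k × Option ι) => S.shock s.1 s.2 ω) P
  /-- the features are independent of the prices and shocks -/
  indep_feature_rest : IndepFun
    (fun ω (s : explorationPeriods d k × ι) => S.feature s.1 s.2 ω)
    (fun ω => ((fun s : explorationPeriods d k × ι => S.price s.1 s.2 ω),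
      fun s : explorationPeriods d k × Option ι => S.shock s.1 s.2 ω)) P
  /-- the consideration sets are independent of the features, prices and shocks -/
  indep_consideration_rest : IndepFun
    (fun ω (t : explorationPeriods d k) => S.consideration t ω)
    (fun ω => ((fun s : explorationPeriods d k × ι => S.feature s.1 s.2 ω),
      (fun s : explorationPeriods d k × ι => S.price s.1 s.2 ω),
      fun s : explorationPeriods d k × Option ι => S.shock s.1 s.2 ω)) P
  /-- the customer chooses an option with the highest utility; ties may be broken in any way -/
  choice_mem : ∀ t ∈ explorationPeriods d k, ∀ ω, S.choice t ω ∈ S.options t ω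
  choice_max : ∀ t ∈ explorationPeriods d k, ∀ ω, ∀ o ∈ S.options t ω,
    S.utility ψ φ ν₀ t ω o ≤ S.utility ψ φ ν₀ t ω (S.choice t ω)

end SalesData

end

end MNLPricing

/-! This is an M-estimator argument in which all concentration is coordinatewise. Write δ = ν̂ - ν₀
and n = kd. The estimate does no worse than ν₀, and the logit log-likelihood is uniformly strongly
convex because utilities are bounded by W and there are at most N + 1 options. Hence
(`log_softmax_sub_ge`) the score at ν₀ in direction δ, plus a constant times the sum over periods of
the squared utility difference of one considered product, is at most zero.

The score is controlled through the shocks. Gumbel noise produces exactly the softmax probabilities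
(`measure_isStrictBest`), so given the consideration sets, features and prices the score is centred,
bounded, and independent across periods. Hoeffding is applied to its 2d coordinates. The score
refers to the strict maximizer of the perturbed utility, which is measurable in the data, and not to
the recorded choice, on which no measurability is imposed; the two agree almost surely.

The quadratic term is controlled through one product per period. `pick` reads only the consideration
set, which is independent of everything else, so the picked features are i.i.d. from D and the
picked prices i.i.d. uniform. Because the price has positive variance, θ and γ can be separated, and
`sum_utility_sq_ge` reduces the lower bound to the entries of three d × d matrices, again by
Hoeffding.

If all 3d² + 2d deviations are at most nε, with ε² = 32 log(kd)/(kd), then ‖δ‖² is at most a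
constant times ε‖δ‖₁ + ε‖δ‖₁². The constraint ‖δ‖₁ ≤ 2W makes the right side linear in ‖δ‖₁, and
‖δ‖₁² ≤ 2d‖δ‖² then gives ‖δ‖² of order dε², which is log(kd)/k. -/

namespace MNLPricing

noncomputable section

/-! ### Strong convexity of the log-partition function -/

/-- Multinomial logit choice probability of the option `o` among the options `s`. -/
def softmax {O : Type*} (s : Finset O) (u : O → ℝ) (o : O) : ℝ :=
  Real.exp (u o) / ∑ o' ∈ s, Real.exp (u o')

section Softmax

variable {O : Type*} {s : Finset O} {u : O → ℝ}

theorem sum_exp_pos (hs : s.Nonempty) (u : O → ℝ) : 0 < ∑ o ∈ s, Real.exp (u o) :=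
  Finset.sum_pos (fun _ _ => Real.exp_pos _) hs

theorem softmax_pos (hs : s.Nonempty) (u : O → ℝ) (o : O) : 0 < softmax s u o :=
  div_pos (Real.exp_pos _) (sum_exp_pos hs u)

theorem sum_softmax (hs : s.Nonempty) (u : O → ℝ) : ∑ o ∈ s, softmax s u o = 1 := by
  simp only [softmax, ← Finset.sum_div]
  exact div_self (sum_exp_pos hs u).ne'

/-- The numerator is at least exp(-W), and the denominator has at most N + 1 terms, each at most exp
W. -/
theorem le_softmax {W : ℝ} {N : ℕ} (hcard : s.card ≤ N + 1)
    (hu : ∀ o ∈ s, |u o| ≤ W) {o : O} (ho : o ∈ s) :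
    Real.exp (-(2 * W)) / (N + 1) ≤ softmax s u o := by
  have h1 : ∑ o' ∈ s, Real.exp (u o') ≤ (N + 1) * Real.exp W := by
    calc ∑ o' ∈ s, Real.exp (u o') ≤ ∑ _o' ∈ s, Real.exp W :=
          Finset.sum_le_sum fun o' ho' => Real.exp_le_exp.2 (abs_le.1 (hu o' ho')).2
      _ = s.card * Real.exp W := by simp
      _ ≤ (N + 1) * Real.exp W := by
          gcongr
          exact_mod_cast hcard
  have h2 : Real.exp (-W) ≤ Real.exp (u o) := Real.exp_le_exp.2 (abs_le.1 (hu o ho)).1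
  have h3 : Real.exp (-(2 * W)) / (N + 1) = Real.exp (-W) / ((N + 1) * Real.exp W) := by
    have : Real.exp (-W) = Real.exp (-(2 * W)) * Real.exp W := by
      rw [← Real.exp_add]; ring_nf
    rw [this]
    field_simp
  rw [h3, softmax]
  have := sum_exp_pos ⟨o, ho⟩ u
  gcongr

end Softmax

/-- For x ≥ -2, squaring 1 + x/2 ≤ exp(x/2) gives the quadratic coefficient 1/4. On [-B, -2] the
quadratic term is at most -x/2, so the left side is already nonpositive. -/
theorem one_add_add_sq_le_exp {B x : ℝ} (hB : 2 ≤ B) (hx : -B ≤ x) :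
    1 + x + x ^ 2 / (2 * B) ≤ Real.exp x := by
  have hB0 : 0 < 2 * B := by linarith
  rcases le_total (-2) x with h | h
  · have h1 : (1 + x / 2) ^ 2 ≤ Real.exp (x / 2) ^ 2 := by
      apply pow_le_pow_left₀ (by linarith)
      linarith [Real.add_one_le_exp (x / 2)]
    have h2 : Real.exp (x / 2) ^ 2 = Real.exp x := by
      rw [sq, ← Real.exp_add]; ring_nf
    have h3 : x ^ 2 / (2 * B) ≤ x ^ 2 / 4 := by
      apply div_le_div_of_nonneg_left (sq_nonneg x) (by norm_num) (by linarith)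
    rw [h2] at h1
    linarith [h1, h3, sq_nonneg x, (by ring : (1 + x / 2) ^ 2 = 1 + x + x ^ 2 / 4)]
  · have h1 : x ^ 2 / (2 * B) ≤ -x / 2 := by
      rw [div_le_div_iff₀ hB0 (by norm_num)]
      nlinarith
    linarith [Real.exp_pos x]

/-- The log-moment generating function of a bounded variable exceeds its mean by a multiple of the
variance. -/
theorem mean_add_variance_le_log {O : Type*} {s : Finset O} {q δ : O → ℝ} {B : ℝ} (hB : 2 ≤ B)
    (hq : ∀ o ∈ s, 0 ≤ q o) (hsum : ∑ o ∈ s, q o = 1)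
    (hδ : ∀ o ∈ s, |δ o - ∑ o' ∈ s, q o' * δ o'| ≤ B) :
    ∑ o ∈ s, q o * δ o + (∑ o ∈ s, q o * (δ o - ∑ o' ∈ s, q o' * δ o') ^ 2) / (2 * B * (1 + B / 2))
      ≤ Real.log (∑ o ∈ s, q o * Real.exp (δ o)) := by
  set μ := ∑ o' ∈ s, q o' * δ o' with hμ
  set V := ∑ o ∈ s, q o * (δ o - μ) ^ 2 with hV
  have hB0 : 0 < B := by linarith
  have hV0 : 0 ≤ V := Finset.sum_nonneg fun o ho => mul_nonneg (hq o ho) (sq_nonneg _)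
  have hVB : V ≤ B ^ 2 := by
    calc V ≤ ∑ o ∈ s, q o * B ^ 2 := Finset.sum_le_sum fun o ho =>
          mul_le_mul_of_nonneg_left (sq_le_sq' (abs_le.1 (hδ o ho)).1 (abs_le.1 (hδ o ho)).2)
            (hq o ho)
      _ = B ^ 2 := by rw [← Finset.sum_mul, hsum, one_mul]
  -- Expanding the exponential around the mean μ kills the linear term and leaves the variance.
  have h1 : Real.exp μ * (1 + V / (2 * B)) ≤ ∑ o ∈ s, q o * Real.exp (δ o) := by
    have h2 : 1 + V / (2 * B) ≤ ∑ o ∈ s, q o * Real.exp (δ o - μ) := by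
      calc 1 + V / (2 * B) = ∑ o ∈ s, q o * (1 + (δ o - μ) + (δ o - μ) ^ 2 / (2 * B)) := by
            have : ∀ o, q o * (1 + (δ o - μ) + (δ o - μ) ^ 2 / (2 * B)) =
                q o * (1 - μ) + q o * δ o + q o * (δ o - μ) ^ 2 / (2 * B) := fun o => by ring
            simp only [this, Finset.sum_add_distrib, ← Finset.sum_mul, hsum, ← Finset.sum_div,
              ← hV, ← hμ]
            ring
        _ ≤ _ := Finset.sum_le_sum fun o ho => mul_le_mul_of_nonneg_left
            (one_add_add_sq_le_exp hB (abs_le.1 (hδ o ho)).1) (hq o ho)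
    calc Real.exp μ * (1 + V / (2 * B)) ≤ Real.exp μ * ∑ o ∈ s, q o * Real.exp (δ o - μ) := by
          gcongr
      _ = _ := by
          rw [Finset.mul_sum]
          refine Finset.sum_congr rfl fun o _ => ?_
          rw [Real.exp_sub]
          field_simp
  have hy : 0 ≤ V / (2 * B) := by positivity
  have hyB : V / (2 * B) ≤ B / 2 := by
    rw [div_le_div_iff₀ (by positivity) (by norm_num)]
    nlinarith
  -- With y = V/(2B), log(1 + y) ≥ y/(1 + y), and y ≤ B/2 because V ≤ B².
  have h3 : V / (2 * B * (1 + B / 2)) ≤ Real.log (1 + V / (2 * B)) := by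
    refine le_trans ?_ (Real.one_sub_inv_le_log_of_pos (by linarith))
    have : 1 - (1 + V / (2 * B))⁻¹ = V / (2 * B) / (1 + V / (2 * B)) := by
      field_simp
      ring
    rw [this, ← div_div]
    gcongr
  calc μ + V / (2 * B * (1 + B / 2)) ≤ μ + Real.log (1 + V / (2 * B)) := by linarith
    _ = Real.log (Real.exp μ * (1 + V / (2 * B))) := by
        rw [Real.log_mul (Real.exp_pos _).ne' (by linarith), Real.log_exp]
    _ ≤ _ := Real.log_le_log (by positivity) h1

/-- Curvature constant of the multinomial logit log-likelihood on utilities bounded by `W`. -/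
def curvature (W : ℝ) (N : ℕ) : ℝ :=
  Real.exp (-(2 * W)) / (N + 1) / 2 / (2 * (4 * W + 2) * (1 + (4 * W + 2) / 2))

theorem curvature_pos {W : ℝ} (hW : 0 ≤ W) (N : ℕ) : 0 < curvature W N := by
  unfold curvature
  positivity

/-- The difference of log-probabilities is log E exp δ - δ(c), where δ = u' - u and the expectation
is under softmax(u). The mean of δ supplies the first-order term, and its variance the curvature: an
option `o₀` of fixed utility forces δ to vary as soon as δ(i) is nonzero. -/
theorem log_softmax_sub_ge {O : Type*} {s : Finset O} {u u' : O → ℝ} {W : ℝ} {N : ℕ} {o₀ : O}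
    (ho₀ : o₀ ∈ s) (h₀ : u o₀ = 0) (h₀' : u' o₀ = 0) (hcard : s.card ≤ N + 1)
    (hu : ∀ o ∈ s, |u o| ≤ W) (hu' : ∀ o ∈ s, |u' o| ≤ W) {i : O} (hi : i ∈ s) (hne : i ≠ o₀)
    (c : O) :
    ∑ o ∈ s, softmax s u o * (u' o - u o) - (u' c - u c) + curvature W N * (u' i - u i) ^ 2 ≤
      Real.log (softmax s u c) - Real.log (softmax s u' c) := by
  classical
  have hs : s.Nonempty := ⟨o₀, ho₀⟩
  have hW : 0 ≤ W := (abs_nonneg _).trans (hu o₀ ho₀)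
  set q := softmax s u with hqdef
  have hq0 : ∀ o ∈ s, 0 ≤ q o := fun o _ => (softmax_pos hs u o).le
  have hq1 : ∑ o ∈ s, q o = 1 := sum_softmax hs u
  set δ : O → ℝ := fun o => u' o - u o with hδdef
  have hδ : ∀ o ∈ s, |δ o| ≤ 2 * W := fun o ho => by
    have := abs_sub (u' o) (u o)
    have h1 := hu o ho
    have h2 := hu' o ho
    simp only [hδdef]
    linarith
  set μ := ∑ o ∈ s, q o * δ o with hμ
  have hμW : |μ| ≤ 2 * W := by
    calc |μ| ≤ ∑ o ∈ s, |q o * δ o| := Finset.abs_sum_le_sum_abs _ _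
      _ ≤ ∑ o ∈ s, q o * (2 * W) := Finset.sum_le_sum fun o ho => by
          rw [abs_mul, abs_of_nonneg (hq0 o ho)]
          exact mul_le_mul_of_nonneg_left (hδ o ho) (hq0 o ho)
      _ = 2 * W := by rw [← Finset.sum_mul, hq1, one_mul]
  have hlog : Real.log (q c) - Real.log (softmax s u' c) =
      Real.log (∑ o ∈ s, q o * Real.exp (δ o)) - δ c := by
    have h1 : ∑ o ∈ s, q o * Real.exp (δ o) =
        (∑ o ∈ s, Real.exp (u' o)) / ∑ o ∈ s, Real.exp (u o) := by
      rw [Finset.sum_div]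
      refine Finset.sum_congr rfl fun o _ => ?_
      simp only [hqdef, hδdef, softmax]
      rw [Real.exp_sub]
      field_simp
    have e1 := sum_exp_pos hs u
    have e2 := sum_exp_pos hs u'
    rw [h1, Real.log_div e2.ne' e1.ne']
    simp only [hqdef, hδdef, softmax]
    rw [Real.log_div (Real.exp_pos _).ne' e1.ne', Real.log_div (Real.exp_pos _).ne' e2.ne',
      Real.log_exp, Real.log_exp]
    ring
  -- Both δ and its mean are at most 2W in absolute value; the extra 2 secures B ≥ 2 even when W is
  -- small.
  have hmain := mean_add_variance_le_log (s := s) (q := q) (δ := δ) (B := 4 * W + 2)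
    (by linarith) hq0 hq1 (fun o ho => by
      have := abs_sub (δ o) μ
      have := hδ o ho
      linarith)
  rw [← hμ] at hmain
  -- Only the options `o₀` and `i` are kept: each has probability bounded below, and μ² + (δ(i) -
  -- μ)² ≥ δ(i)²/2.
  have hvar : Real.exp (-(2 * W)) / (N + 1) / 2 * δ i ^ 2 ≤ ∑ o ∈ s, q o * (δ o - μ) ^ 2 := by
    have h1 : ∑ o ∈ ({o₀, i} : Finset O), q o * (δ o - μ) ^ 2 ≤ ∑ o ∈ s, q o * (δ o - μ) ^ 2 :=
      Finset.sum_le_sum_of_subset_of_nonneg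
        (by intro o ho; rcases Finset.mem_insert.1 ho with rfl | h
            · exact ho₀
            · rw [Finset.mem_singleton.1 h]; exact hi)
        fun o ho _ => mul_nonneg (hq0 o ho) (sq_nonneg _)
    rw [Finset.sum_pair hne.symm] at h1
    have hδ0 : δ o₀ = 0 := by simp [hδdef, h₀, h₀']
    have q1 := le_softmax hcard hu ho₀
    have q2 := le_softmax hcard hu hi
    rw [← hqdef] at q1 q2
    refine le_trans ?_ h1
    set p := Real.exp (-(2 * W)) / (N + 1)
    have hp : 0 ≤ p := by positivity
    rw [hδ0]
    have := mul_le_mul_of_nonneg_right q1 (sq_nonneg (0 - μ))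
    have := mul_le_mul_of_nonneg_right q2 (sq_nonneg (δ i - μ))
    nlinarith [mul_nonneg hp (sq_nonneg (δ i - 2 * μ))]
  rw [hlog]
  have : curvature W N * δ i ^ 2 ≤ (∑ o ∈ s, q o * (δ o - μ) ^ 2) /
      (2 * (4 * W + 2) * (1 + (4 * W + 2) / 2)) := by
    have h0 : 0 < 2 * (4 * W + 2) * (1 + (4 * W + 2) / 2) := by positivity
    rw [le_div_iff₀ h0]
    refine le_trans (le_of_eq ?_) hvar
    unfold curvature
    field_simp
  change μ - δ c + curvature W N * δ i ^ 2 ≤ _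
  linarith

/-! ### Conditioning on an independent variable -/

section Conditioning

variable {Ω α β : Type*} [MeasurableSpace Ω] [MeasurableSpace α] [MeasurableSpace β]
  {P : Measure Ω} [IsProbabilityMeasure P] {A : Ω → α} {B : Ω → β}

/-- Fubini for the product law of (A, B): conditioning on A amounts to freezing it at A(ω') while B
keeps its law. -/
theorem measure_le_of_indepFun (hA : Measurable A) (hB : Measurable B) (hAB : IndepFun A B P)
    {s : Set (α × β)} (hs : MeasurableSet s) {c : ENNReal}
    (h : ∀ᵐ ω' ∂P, P {ω | (A ω', B ω) ∈ s} ≤ c) : P {ω | (A ω, B ω) ∈ s} ≤ c := by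
  have h1 : P {ω | (A ω, B ω) ∈ s} = P.map (fun ω => (A ω, B ω)) s :=
    (Measure.map_apply (hA.prodMk hB) hs).symm
  have : IsProbabilityMeasure (P.map B) := Measure.isProbabilityMeasure_map hB.aemeasurable
  rw [h1, (indepFun_iff_map_prod_eq_prod_map_map hA.aemeasurable hB.aemeasurable).1 hAB,
    Measure.prod_apply hs, lintegral_map (measurable_measure_prodMk_left hs) hA]
  calc ∫⁻ ω', P.map B (Prod.mk (A ω') ⁻¹' s) ∂P ≤ ∫⁻ _, c ∂P := by
        refine lintegral_mono_ae ?_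
        filter_upwards [h] with ω' hω'
        rw [Measure.map_apply hB (measurable_prodMk_left hs)]
        exact hω'
    _ = c := by simp

theorem ae_of_indepFun (hA : Measurable A) (hB : Measurable B) (hAB : IndepFun A B P)
    {s : Set (α × β)} (hs : MeasurableSet s)
    (h : ∀ᵐ ω' ∂P, ∀ᵐ ω ∂P, (A ω', B ω) ∈ s) : ∀ᵐ ω ∂P, (A ω, B ω) ∈ s := by
  rw [ae_iff, ← nonpos_iff_eq_zero]
  refine measure_le_of_indepFun hA hB hAB (s := sᶜ) hs.compl ?_
  filter_upwards [h] with ω' hω'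
  rw [nonpos_iff_eq_zero]
  exact ae_iff.1 hω'

/-- The two hypotheses make the joint law a triple product measure, which is then reassociated. This
turns the nested independence assumptions on the data into the splits needed for conditioning. -/
theorem indepFun_prodMk_left_of_indepFun
    {γ : Type*} [MeasurableSpace γ] {C : Ω → γ}
    (hA : Measurable A) (hB : Measurable B) (hC : Measurable C)
    (h : IndepFun A (fun ω => (B ω, C ω)) P) (hBC : IndepFun B C P) :
    IndepFun (fun ω => (A ω, B ω)) C P := by
  have : IsProbabilityMeasure (P.map A) := Measure.isProbabilityMeasure_map hA.aemeasurable
  have : IsProbabilityMeasure (P.map B) := Measure.isProbabilityMeasure_map hB.aemeasurable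
  have : IsProbabilityMeasure (P.map C) := Measure.isProbabilityMeasure_map hC.aemeasurable
  have hAB : IndepFun A B P := h.comp measurable_id measurable_fst
  rw [indepFun_iff_map_prod_eq_prod_map_map (hA.prodMk hB).aemeasurable hC.aemeasurable,
    (indepFun_iff_map_prod_eq_prod_map_map hA.aemeasurable hB.aemeasurable).1 hAB]
  have h1 := (indepFun_iff_map_prod_eq_prod_map_map hA.aemeasurable
    (hB.prodMk hC).aemeasurable).1 h
  rw [(indepFun_iff_map_prod_eq_prod_map_map hB.aemeasurable hC.aemeasurable).1 hBC] at h1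
  have h2 : (fun ω => ((A ω, B ω), C ω)) =
      MeasurableEquiv.prodAssoc.symm ∘ fun ω => (A ω, (B ω, C ω)) := rfl
  rw [h2, ← Measure.map_map MeasurableEquiv.prodAssoc.symm.measurable (hA.prodMk (hB.prodMk hC)),
    h1]
  exact (measurePreserving_prodAssoc _ _ _).symm.map_eq

theorem measure_abs_sum_ge_le {κ : Type*} [Fintype κ] {X : κ → Ω → ℝ}
    (hX : ∀ t, AEMeasurable (X t) P) (hind : iIndepFun X P)
    (hbound : ∀ t, ∀ᵐ ω ∂P, X t ω ∈ Set.Icc (-2 : ℝ) 2) (hmean : ∀ t, ∫ ω, X t ω ∂P = 0)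
    {ε : ℝ} (hε : 0 ≤ ε) :
    P {ω | Fintype.card κ * ε ≤ |∑ t, X t ω|} ≤
      ENNReal.ofReal (2 * Real.exp (-(Fintype.card κ * ε ^ 2 / 8))) := by
  -- An interval of length 4 gives variance proxy (4/2)² = 4, so with n terms the exponent is
  -- (nε)²/(2·4n) = nε²/8.
  have hsub : ∀ t, HasSubgaussianMGF (X t) 4 P := fun t => by
    convert! hasSubgaussianMGF_of_mem_Icc_of_integral_eq_zero (hX t) (hbound t) (hmean t) using 1
    ext
    norm_num
  have key : ∀ Y : κ → Ω → ℝ, iIndepFun Y P → (∀ t, HasSubgaussianMGF (Y t) 4 P) →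
      P.real {ω | Fintype.card κ * ε ≤ ∑ t, Y t ω} ≤
        Real.exp (-(Fintype.card κ * ε ^ 2 / 8)) := fun Y hY hYs => by
    refine (HasSubgaussianMGF.measure_sum_ge_le_of_iIndepFun hY (s := Finset.univ)
      (fun t _ => hYs t) (by positivity)).trans (le_of_eq ?_)
    congr 1
    simp only [Finset.sum_const, Finset.card_univ, nsmul_eq_mul, NNReal.coe_mul, NNReal.coe_natCast,
      NNReal.coe_ofNat]
    rcases eq_or_ne (Fintype.card κ : ℝ) 0 with h | h
    · simp [h]
    · field_simp
      ring
  have h1 := key X hind hsub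
  have h2 := key (fun t => -X t) (hind.comp (fun _ x => -x) fun _ => measurable_neg)
    fun t => (hsub t).neg
  rw [← ofReal_measureReal]
  refine ENNReal.ofReal_le_ofReal ?_
  calc P.real {ω | Fintype.card κ * ε ≤ |∑ t, X t ω|}
      ≤ P.real ({ω | Fintype.card κ * ε ≤ ∑ t, X t ω} ∪
          {ω | Fintype.card κ * ε ≤ ∑ t, (-X t) ω}) := by
        refine measureReal_mono fun ω hω => ?_
        simp only [Set.mem_ofPred_eq, Set.mem_union, Pi.neg_apply, Finset.sum_neg_distrib] at hω ⊢
        exact le_abs.1 hω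
    _ ≤ _ := (measureReal_union_le _ _).trans (by linarith)

/-- Hoeffding's inequality for sums that are independent, bounded and centred conditionally on a
variable `A` independent of `B`. -/
theorem measure_abs_sum_ge_le_of_indepFun {κ : Type*} [Fintype κ]
    (hA : Measurable A) (hB : Measurable B) (hAB : IndepFun A B P) {f : κ → α × β → ℝ}
    (hf : ∀ t, Measurable (f t))
    (hind : ∀ ω', iIndepFun (fun t ω => f t (A ω', B ω)) P)
    (hbound : ∀ᵐ ω' ∂P, ∀ t, ∀ᵐ ω ∂P, f t (A ω', B ω) ∈ Set.Icc (-2 : ℝ) 2)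
    (hmean : ∀ ω' t, ∫ ω, f t (A ω', B ω) ∂P = 0) {ε : ℝ} (hε : 0 ≤ ε) :
    P {ω | Fintype.card κ * ε ≤ |∑ t, f t (A ω, B ω)|} ≤
      ENNReal.ofReal (2 * Real.exp (-(Fintype.card κ * ε ^ 2 / 8))) := by
  refine measure_le_of_indepFun hA hB hAB (s := {x | Fintype.card κ * ε ≤ |∑ t, f t x|})
    (measurableSet_le measurable_const (by fun_prop)) ?_
  filter_upwards [hbound] with ω' h
  exact measure_abs_sum_ge_le
    (fun t => ((hf t).comp (measurable_const.prodMk hB)).aemeasurable) (hind ω') h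
    (hmean ω') hε

end Conditioning

/-! ### The Gumbel law and the multinomial logit probabilities -/

/-- The integrand has the antiderivative -exp(-S exp y)/S, which vanishes at infinity. -/
theorem lintegral_Ioi_exp_mul_exp_neg {S : ℝ} (hS : 0 < S) (b : ℝ) :
    ∫⁻ y in Set.Ioi b, ENNReal.ofReal (Real.exp (y - S * Real.exp y)) =
      ENNReal.ofReal (Real.exp (-(S * Real.exp b)) / S) := by
  have hderiv : ∀ y ∈ Set.Ici b, HasDerivAt (fun y => -(Real.exp (-(S * Real.exp y)) / S))
      (Real.exp (y - S * Real.exp y)) y := fun y _ => by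
    have h := (((((Real.hasDerivAt_exp y).const_mul S).neg).exp).div_const S).neg
    convert! h using 1
    simp only [Pi.neg_apply]
    rw [sub_eq_add_neg, Real.exp_add]
    field_simp
  have hlim : Filter.Tendsto (fun y => -(Real.exp (-(S * Real.exp y)) / S)) Filter.atTop
      (nhds 0) := by
    have h : Filter.Tendsto (fun y => Real.exp (-(S * Real.exp y))) Filter.atTop (nhds 0) :=
      Real.tendsto_exp_neg_atTop_nhds_zero.comp
        (Real.tendsto_exp_atTop.const_mul_atTop hS)
    simpa using (h.div_const S).neg
  have hnn : ∀ y ∈ Set.Ioi b, 0 ≤ Real.exp (y - S * Real.exp y) := fun y _ => (Real.exp_pos _).le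
  rw [← ofReal_integral_eq_lintegral_ofReal (integrableOn_Ioi_deriv_of_nonneg' hderiv hnn hlim)
    (Filter.Eventually.of_forall fun y => (Real.exp_pos _).le),
    integral_Ioi_of_hasDerivAt_of_nonneg' hderiv hnn hlim]
  simp

theorem gumbelMeasure_Iio (m a : ℝ) :
    gumbelMeasure m (Set.Iio a) = ENNReal.ofReal (Real.exp (-Real.exp (-(a - m)))) := by
  rw [gumbelMeasure, withDensity_apply _ measurableSet_Iio]
  have h := (Measure.measurePreserving_sub_left (volume : Measure ℝ) m).setLIntegral_comp_preimage_emb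
    (MeasurableEquiv.subLeft m).measurableEmbedding
    (fun y => ENNReal.ofReal (Real.exp (y - 1 * Real.exp y))) (Set.Ioi (m - a))
  rw [lintegral_Ioi_exp_mul_exp_neg one_pos] at h
  have h2 : (fun y => m - y) ⁻¹' Set.Ioi (m - a) = Set.Iio a := by
    ext y; simp
  rw [h2] at h
  simpa using h

/-- The integrand is 1/S times the Gumbel density translated by log S, and translation preserves
total mass one. -/
theorem lintegral_gumbel_shift {m : ℝ} [IsProbabilityMeasure (gumbelMeasure m)] {S : ℝ}
    (hS : 0 < S) :
    ∫⁻ y, ENNReal.ofReal (Real.exp (-(S * Real.exp (-(y - m))))) * ENNReal.ofReal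
      (Real.exp (-(y - m))) = ENNReal.ofReal (1 / S) := by
  have h1 : gumbelMeasure m Set.univ = 1 := measure_univ
  rw [gumbelMeasure, withDensity_apply _ MeasurableSet.univ, Measure.restrict_univ] at h1
  have h2 := lintegral_sub_right_eq_self (μ := (volume : Measure ℝ))
    (fun y => ENNReal.ofReal (Real.exp (-(y - m) - Real.exp (-(y - m))))) (Real.log S)
  rw [h1] at h2
  have h3 : ∀ y, ENNReal.ofReal (Real.exp (-(S * Real.exp (-(y - m))))) * ENNReal.ofReal
      (Real.exp (-(y - m))) = ENNReal.ofReal (1 / S) * ENNReal.ofReal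
        (Real.exp (-(y - Real.log S - m) - Real.exp (-(y - Real.log S - m)))) := fun y => by
    rw [← ENNReal.ofReal_mul (Real.exp_pos _).le, ← ENNReal.ofReal_mul (by positivity)]
    congr 1
    have : Real.exp (-(y - Real.log S - m)) = S * Real.exp (-(y - m)) := by
      rw [show -(y - Real.log S - m) = Real.log S + -(y - m) by ring, Real.exp_add,
        Real.exp_log hS]
    rw [sub_eq_add_neg (-(y - Real.log S - m)), Real.exp_add, this]
    field_simp
  simp only [h3]
  rw [lintegral_const_mul' _ _ ENNReal.ofReal_ne_top, h2, mul_one]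

/-- The option `o` is the unique maximizer of the perturbed utility `u + z` among the options `s`. -/
def IsStrictBest {O : Type*} (s : Finset O) (u z : O → ℝ) (o : O) : Prop :=
  o ∈ s ∧ ∀ o' ∈ s, o' ≠ o → u o' + z o' < u o + z o

theorem IsStrictBest.unique {O : Type*} {s : Finset O} {u z : O → ℝ} {o o' : O}
    (h : IsStrictBest s u z o) (h' : IsStrictBest s u z o') : o = o' := by
  by_contra hne
  exact lt_asymm (h.2 o' h'.1 (Ne.symm hne)) (h'.2 o h.1 hne)

theorem measurableSet_isStrictBest {O X : Type*} [MeasurableSpace X] {s : Finset O}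
    {u z : X → O → ℝ} (hu : ∀ o, Measurable fun x => u x o) (hz : ∀ o, Measurable fun x => z x o)
    (o : O) : MeasurableSet {x | IsStrictBest s (u x) (z x) o} := by
  by_cases ho : o ∈ s
  · have : {x | IsStrictBest s (u x) (z x) o} =
        ⋂ o' ∈ s, {x | o' ≠ o → u x o' + z x o' < u x o + z x o} := by
      ext x; simp [IsStrictBest, ho]
    rw [this]
    refine Finset.measurableSet_biInter _ fun o' _ => ?_
    by_cases h : o' = o
    · simp [h]
    · simp only [ne_eq, h, not_false_eq_true, forall_const]
      exact measurableSet_lt ((hu _).add (hz _)) ((hu _).add (hz _))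
  · simp [IsStrictBest, ho]

section Gumbel

variable {Ω O : Type*} [MeasurableSpace Ω] {P : Measure Ω} [IsProbabilityMeasure P]
  {z : O → Ω → ℝ} {m : ℝ}

/-- Gumbel shocks lead to multinomial logit choice probabilities. -/
theorem measure_isStrictBest (hz : ∀ o, Measurable (z o)) (hind : iIndepFun z P)
    (hlaw : ∀ o, P.map (z o) = gumbelMeasure m) {s : Finset O} (u : O → ℝ) {o : O} (ho : o ∈ s) :
    P {ω | IsStrictBest s u (fun o' => z o' ω) o} = ENNReal.ofReal (softmax s u o) := by
  classical
  have hprob : IsProbabilityMeasure (gumbelMeasure m) :=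
    hlaw o ▸ Measure.isProbabilityMeasure_map (hz o).aemeasurable
  have hindep := hind.indepFun_finset {o} (s.erase o) (by simp) hz
  have hindep' : IndepFun (z o) (fun ω (i : s.erase o) => z i ω) P :=
    hindep.comp (φ := fun f : ({o} : Finset O) → ℝ => f ⟨o, Finset.mem_singleton_self o⟩)
      (ψ := fun f => f) (measurable_pi_apply _) measurable_id
  have hM : Measurable fun ω (i : s.erase o) => z i ω := measurable_pi_lambda _ fun i => hz i
  set E : Set (ℝ × (s.erase o → ℝ)) := {x | ∀ i : s.erase o, u i + x.2 i < u o + x.1} with hE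
  have hEm : MeasurableSet E := by
    rw [hE, Set.ofPred_forall]
    exact MeasurableSet.iInter fun i => measurableSet_lt (by fun_prop) (by fun_prop)
  have h1 : {ω | IsStrictBest s u (fun o' => z o' ω) o} =
      (fun ω => (z o ω, fun i : s.erase o => z i ω)) ⁻¹' E := by
    ext ω
    simp only [IsStrictBest, ho, true_and, hE, Set.mem_ofPred_eq, Set.mem_preimage, Subtype.forall,
      Finset.mem_erase]
    exact ⟨fun h i hi => h i hi.2 hi.1, fun h i hi hne => h i ⟨hne, hi⟩⟩
  -- Given that the shock of `o` equals y, the option wins when every other shock lies below a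
  -- threshold; the product of Gumbel distribution functions is a single double exponential.
  have hfib : ∀ y, P.map (fun ω (i : s.erase o) => z i ω) (Prod.mk y ⁻¹' E) =
      ENNReal.ofReal (Real.exp (-((∑ i ∈ s.erase o, Real.exp (u i - u o)) *
        Real.exp (-(y - m))))) := fun y => by
    rw [Measure.map_apply hM (measurable_prodMk_left hEm)]
    have h2 : (fun ω (i : s.erase o) => z i ω) ⁻¹' (Prod.mk y ⁻¹' E) =
        ⋂ i ∈ s.erase o, z i ⁻¹' Set.Iio (y + (u o - u i)) := by
      ext ω
      simp only [hE, Set.mem_preimage, Set.mem_ofPred_eq, Subtype.forall, Set.mem_iInter, Set.mem_Iio]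
      exact forall₂_congr fun i _ => by constructor <;> intro h <;> linarith
    rw [h2, hind.measure_inter_preimage_eq_mul (s.erase o) fun i _ => measurableSet_Iio]
    have h3 : ∀ i, P (z i ⁻¹' Set.Iio (y + (u o - u i))) =
        ENNReal.ofReal (Real.exp (-(Real.exp (u i - u o) * Real.exp (-(y - m))))) := fun i => by
      rw [← Measure.map_apply (hz i) measurableSet_Iio, hlaw, gumbelMeasure_Iio, ← Real.exp_add]
      ring_nf
    simp only [h3]
    rw [← ENNReal.ofReal_prod_of_nonneg fun i _ => (Real.exp_pos _).le, ← Real.exp_sum,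
      Finset.sum_neg_distrib, Finset.sum_mul]
  have : IsProbabilityMeasure (P.map fun ω (i : s.erase o) => z i ω) :=
    Measure.isProbabilityMeasure_map hM.aemeasurable
  rw [h1, ← Measure.map_apply ((hz o).prodMk hM) hEm,
    (indepFun_iff_map_prod_eq_prod_map_map (hz o).aemeasurable hM.aemeasurable).1 hindep',
    Measure.prod_apply hEm, hlaw]
  simp only [hfib]
  rw [gumbelMeasure, lintegral_withDensity_eq_lintegral_mul _ (by fun_prop) (by fun_prop)]
  set R := ∑ i ∈ s.erase o, Real.exp (u i - u o) with hR
  have hR0 : 0 ≤ R := Finset.sum_nonneg fun i _ => (Real.exp_pos _).le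
  -- R comes from the competitors, the 1 from the density of the shock of `o` itself.
  have h4 := lintegral_gumbel_shift (m := m) (S := 1 + R) (by linarith)
  have h5 : softmax s u o = 1 / (1 + R) := by
    have : ∑ o' ∈ s, Real.exp (u o') = Real.exp (u o) * (1 + R) := by
      rw [← Finset.add_sum_erase s _ ho, hR, mul_add, mul_one, Finset.mul_sum]
      congr 1
      refine Finset.sum_congr rfl fun i _ => ?_
      rw [← Real.exp_add]; ring_nf
    rw [softmax, this]
    have := Real.exp_pos (u o)
    field_simp
  rw [h5, ← h4]
  refine lintegral_congr fun y => ?_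
  simp only [Pi.mul_apply]
  rw [← ENNReal.ofReal_mul (Real.exp_pos _).le, ← ENNReal.ofReal_mul (Real.exp_pos _).le,
    ← Real.exp_add, ← Real.exp_add]
  ring_nf

/-- The events of being strictly best are disjoint and their softmax probabilities add up to one, so
ties have probability zero. -/
theorem ae_exists_isStrictBest (hz : ∀ o, Measurable (z o)) (hind : iIndepFun z P)
    (hlaw : ∀ o, P.map (z o) = gumbelMeasure m) {s : Finset O} (hs : s.Nonempty) (u : O → ℝ) :
    ∀ᵐ ω ∂P, ∃ o ∈ s, IsStrictBest s u (fun o' => z o' ω) o := by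
  have hm : ∀ o, MeasurableSet {ω | IsStrictBest s u (fun o' => z o' ω) o} :=
    measurableSet_isStrictBest (u := fun _ => u) (fun _ => measurable_const) hz
  have h1 : P (⋃ o ∈ s, {ω | IsStrictBest s u (fun o' => z o' ω) o}) = 1 := by
    have hdisj : (s : Set O).PairwiseDisjoint
        fun o => {ω | IsStrictBest s u (fun o' => z o' ω) o} := fun o _ o' _ hne =>
      Set.disjoint_left.2 fun ω h h' =>
        hne (IsStrictBest.unique (s := s) (u := u) (z := fun o' => z o' ω) h h')
    rw [measure_biUnion_finset hdisj fun o _ => hm o,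
      Finset.sum_congr rfl fun o ho => measure_isStrictBest hz hind hlaw u ho,
      ← ENNReal.ofReal_sum_of_nonneg fun o _ => (softmax_pos hs u o).le, sum_softmax hs,
      ENNReal.ofReal_one]
  have h2 := (prob_compl_eq_zero_iff (Finset.measurableSet_biUnion s fun o _ => hm o)).2 h1
  filter_upwards [measure_eq_zero_iff_ae_notMem.1 h2] with ω hω
  simpa using hω

end Gumbel

/-- The joint law is an infinite product measure, and currying it gives a product of product
measures. It is used to group the shocks into one vector per period. -/
theorem iIndepFun_curry {Ω ι κ E : Type*} [MeasurableSpace Ω] [MeasurableSpace E] {P : Measure Ω}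
    [IsProbabilityMeasure P] {X : ι × κ → Ω → E} (hX : ∀ p, Measurable (X p))
    (h : iIndepFun X P) : iIndepFun (fun i ω j => X (i, j) ω) P := by
  have hp : ∀ p, IsProbabilityMeasure (P.map (X p)) := fun p =>
    Measure.isProbabilityMeasure_map (hX p).aemeasurable
  rw [iIndepFun_iff_map_fun_eq_infinitePi_map fun i => measurable_pi_lambda _ fun j => hX (i, j)]
  have h1 : (fun ω i j => X (i, j) ω) = (MeasurableEquiv.curry ι κ E) ∘ fun ω p => X p ω := rfl
  have h2 : ∀ i, P.map (fun ω j => X (i, j) ω) =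
      Measure.infinitePi fun j => P.map (X (i, j)) := fun i =>
    (h.precomp (g := fun j => (i, j)) fun _ _ hjj => (Prod.mk.inj hjj).2).map_fun_eq_infinitePi_map
      fun j => hX (i, j)
  simp only [h2]
  rw [h1, ← Measure.map_map (MeasurableEquiv.curry ι κ E).measurable (measurable_pi_lambda _ hX),
    h.map_fun_eq_infinitePi_map hX]
  exact Measure.infinitePi_map_curry fun i j => P.map (X (i, j))

/-! ### Utilities and scores -/

variable {r d : ℕ} {ι : Type*}

/-- Deterministic utilities of products with features `x` and prices `p`. -/
def linUtility (φ : Vec r → Vec d) (ν : Param d) (x : ι → Vec r) (p : ι → ℝ) : Option ι → ℝ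
  | none => 0
  | some i => inner ℝ (φ (x i)) ν.1 - inner ℝ (φ (x i)) ν.2 * p i

theorem SalesData.baseUtility_eq {Ω : Type*} (S : SalesData Ω ι r) (φ : Vec r → Vec d)
    (ν : Param d) (t : ℕ) (ω : Ω) (o : Option ι) :
    S.baseUtility φ ν t ω o = linUtility φ ν (S.feature t · ω) (S.price t · ω) o := by
  cases o <;> rfl

theorem inner_eq_sum (x y : Vec d) : inner ℝ x y = ∑ j, x j * y j := by
  simp [PiLp.inner_apply, mul_comm]

theorem abs_inner_le {x : Vec d} (hx : ∀ j, |x j| ≤ 1) (y : Vec d) :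
    |inner ℝ x y| ≤ ∑ j, |y j| := by
  rw [inner_eq_sum]
  refine (Finset.abs_sum_le_sum_abs _ _).trans (Finset.sum_le_sum fun j _ => ?_)
  rw [abs_mul]
  exact mul_le_of_le_one_left (abs_nonneg _) (hx j)

theorem abs_linUtility_le {φ : Vec r → Vec d} (ν : Param d) {x : ι → Vec r} {p : ι → ℝ}
    {o : Option ι} (hx : ∀ i, o = some i → ∀ j, |φ (x i) j| ≤ 1)
    (hp : ∀ i, o = some i → p i ∈ Set.Icc (0 : ℝ) 1) :
    |linUtility φ ν x p o| ≤ l1Norm ν := by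
  cases o with
  | none =>
    simp only [linUtility, abs_zero, l1Norm]
    positivity
  | some i =>
    have h1 := abs_inner_le (hx i rfl) ν.1
    have h2 := abs_inner_le (hx i rfl) ν.2
    obtain ⟨hp0, hp1⟩ := hp i rfl
    simp only [linUtility, l1Norm]
    calc _ ≤ |inner ℝ (φ (x i)) ν.1| + |inner ℝ (φ (x i)) ν.2 * p i| := abs_sub _ _
      _ ≤ _ := by
          rw [abs_mul, abs_of_nonneg hp0]
          have := mul_le_of_le_one_right (abs_nonneg (inner ℝ (φ (x i)) ν.2)) hp1
          linarith

theorem measurable_linUtility {X : Type*} [MeasurableSpace X] {φ : Vec r → Vec d}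
    (hφ : Measurable φ) (ν : Param d) {x : X → ι → Vec r} {p : X → ι → ℝ}
    (hx : ∀ i, Measurable fun y => x y i) (hp : ∀ i, Measurable fun y => p y i) (o : Option ι) :
    Measurable fun y => linUtility φ ν (x y) (p y) o := by
  cases o with
  | none => exact measurable_const
  | some i =>
    have h := hφ.comp (hx i)
    simp only [linUtility]
    exact (h.inner measurable_const).sub ((h.inner measurable_const).mul (hp i))

/-- Derivative of the negative log-likelihood of the utility-maximizing option in the direction
`w`. -/
def score {O : Type*} (s : Finset O) (u z w : O → ℝ) : ℝ :=
  ∑ o ∈ s, softmax s u o * w o - ∑ o ∈ s, Set.indicator {o | IsStrictBest s u z o} w o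

section Score

variable {O : Type*} {s : Finset O} {u z w : O → ℝ}

theorem score_eq {o : O} (h : IsStrictBest s u z o) :
    score s u z w = ∑ o' ∈ s, softmax s u o' * w o' - w o := by
  have h1 : ∑ o ∈ s, Set.indicator {o | IsStrictBest s u z o} w o = w o := by
    rw [Finset.sum_eq_single_of_mem o h.1 fun o' _ hne => Set.indicator_of_notMem
      (s := {o | IsStrictBest s u z o}) (fun h' => hne (IsStrictBest.unique h' h)) w]
    exact Set.indicator_of_mem (s := {o | IsStrictBest s u z o}) h w
  rw [score, h1]

theorem abs_score_le (hs : s.Nonempty) (hw : ∀ o ∈ s, |w o| ≤ 1) : |score s u z w| ≤ 2 := by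
  have h1 : |∑ o ∈ s, softmax s u o * w o| ≤ 1 := by
    calc _ ≤ ∑ o ∈ s, |softmax s u o * w o| := Finset.abs_sum_le_sum_abs _ _
      _ ≤ ∑ o ∈ s, softmax s u o := Finset.sum_le_sum fun o ho => by
          rw [abs_mul, abs_of_pos (softmax_pos hs u o)]
          exact mul_le_of_le_one_right (softmax_pos hs u o).le (hw o ho)
      _ = 1 := sum_softmax hs u
  by_cases h : ∃ o, IsStrictBest s u z o
  · obtain ⟨o, ho⟩ := h
    rw [score_eq ho]
    exact (abs_sub _ _).trans (by linarith [hw o ho.1])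
  -- In case of ties the indicator sum is empty, so the bound holds everywhere and not only almost
  -- surely.
  · push Not at h
    have h2 : ∑ o ∈ s, Set.indicator {o | IsStrictBest s u z o} w o = 0 :=
      Finset.sum_eq_zero fun o _ =>
        Set.indicator_of_notMem (s := {o | IsStrictBest s u z o}) (h o) w
    rw [score, h2, sub_zero]
    linarith

theorem measurable_score {X : Type*} [MeasurableSpace X] (s : Finset O)
    {u z w : X → O → ℝ} (hu : ∀ o, Measurable fun x => u x o) (hz : ∀ o, Measurable fun x => z x o)
    (hw : ∀ o, Measurable fun x => w x o) : Measurable fun x => score s (u x) (z x) (w x) := by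
  unfold score softmax
  refine Measurable.sub (by fun_prop) (Finset.measurable_sum _ fun o _ => ?_)
  exact (hw o).indicator (measurableSet_isStrictBest (s := s) hu hz o)

/-- Each option is strictly best with exactly its softmax probability, so the two sums have the same
mean. -/
theorem integral_score {Ω : Type*} [MeasurableSpace Ω] {P : Measure Ω} [IsProbabilityMeasure P]
    {z : O → Ω → ℝ} {m : ℝ} (hz : ∀ o, Measurable (z o)) (hind : iIndepFun z P)
    (hlaw : ∀ o, P.map (z o) = gumbelMeasure m) (hs : s.Nonempty) (u w : O → ℝ) :
    ∫ ω, score s u (fun o => z o ω) w ∂P = 0 := by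
  have hm : ∀ o, MeasurableSet {ω | IsStrictBest s u (fun o' => z o' ω) o} :=
    measurableSet_isStrictBest (u := fun _ => u) (fun _ => measurable_const) hz
  have h1 : ∀ o ω, Set.indicator {o | IsStrictBest s u (fun o => z o ω) o} w o =
      Set.indicator {ω | IsStrictBest s u (fun o' => z o' ω) o} (fun _ => w o) ω :=
    fun o ω => rfl
  simp only [score, h1]
  rw [integral_sub (integrable_const _)
    (integrable_finsetSum _ fun o _ => (integrable_const _).indicator (hm o)),
    integral_const, integral_finsetSum _ fun o _ => (integrable_const _).indicator (hm o)]
  rw [probReal_univ, one_smul, sub_eq_zero]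
  refine Finset.sum_congr rfl fun o ho => ?_
  rw [integral_indicator_const _ (hm o), measureReal_def, measure_isStrictBest hz hind hlaw u ho,
    ENNReal.toReal_ofReal (softmax_pos hs u o).le, smul_eq_mul]

end Score

/-- A product of the consideration set `c`. -/
def pick [Nonempty ι] (c : Finset ι) : ι := Classical.epsilon (· ∈ c)

theorem pick_mem [Nonempty ι] {c : Finset ι} (hc : c.Nonempty) : pick c ∈ c :=
  Classical.epsilon_spec hc

/-! ### Concentration over the exploration periods -/

/-- The score of period `t` in the direction `μ`, as a function of the consideration sets, the
features, the prices and the shocks. -/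
def periodScore {r d : ℕ} {ι κ : Type*} (φ : Vec r → Vec d) (ν₀ μ : Param d) (t : κ)
    (y : ((κ → Finset ι) × ((κ × ι → Vec r) × (κ × ι → ℝ))) × (κ × Option ι → ℝ)) : ℝ :=
  score (Finset.insertNone (y.1.1 t))
    (linUtility φ ν₀ (fun i => y.1.2.1 (t, i)) fun i => y.1.2.2 (t, i)) (fun o => y.2 (t, o))
    (linUtility φ μ (fun i => y.1.2.1 (t, i)) fun i => y.1.2.2 (t, i))

/-- There are only countably many profiles of consideration sets, so measurability may be checked
with the profile fixed, when the sums run over a fixed finite set. -/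
theorem measurable_periodScore {r d : ℕ} {ι κ : Type*} [Countable ι] [Finite κ]
    {φ : Vec r → Vec d} (hφ : Measurable φ) (ν₀ μ : Param d) (t : κ) :
    Measurable (periodScore (ι := ι) φ ν₀ μ t) := by
  have hc : ∀ c : κ → Finset ι, Measurable
      fun x : ((κ × ι → Vec r) × (κ × ι → ℝ)) × (κ × Option ι → ℝ) =>
        periodScore φ ν₀ μ t ((c, x.1), x.2) := fun c => by
    unfold periodScore
    exact measurable_score (Finset.insertNone (c t))
      (measurable_linUtility hφ _ (fun i => by fun_prop) fun i => by fun_prop)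
      (fun o => by fun_prop)
      (measurable_linUtility hφ _ (fun i => by fun_prop) fun i => by fun_prop)
  have h : Measurable fun x : (κ → Finset ι) ×
      (((κ × ι → Vec r) × (κ × ι → ℝ)) × (κ × Option ι → ℝ)) =>
        periodScore φ ν₀ μ t ((x.1, x.2.1), x.2.2) := measurable_from_prod_countable_right hc
  have h2 : periodScore (ι := ι) φ ν₀ μ t = (fun x : (κ → Finset ι) ×
      (((κ × ι → Vec r) × (κ × ι → ℝ)) × (κ × Option ι → ℝ)) =>
        periodScore φ ν₀ μ t ((x.1, x.2.1), x.2.2)) ∘ MeasurableEquiv.prodAssoc := by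
    ext ⟨⟨_, _⟩, _⟩
    rfl
  rw [h2]
  exact h.comp MeasurableEquiv.prodAssoc.measurable

theorem measurableSet_exists_isStrictBest {r d : ℕ} {ι κ : Type*} [Countable ι] [Finite κ]
    {φ : Vec r → Vec d} (hφ : Measurable φ) (ν₀ : Param d) (t : κ) :
    MeasurableSet {y : ((κ → Finset ι) × ((κ × ι → Vec r) × (κ × ι → ℝ))) × (κ × Option ι → ℝ) |
      ∃ o, IsStrictBest (Finset.insertNone (y.1.1 t))
        (linUtility φ ν₀ (fun i => y.1.2.1 (t, i)) fun i => y.1.2.2 (t, i))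
        (fun o => y.2 (t, o)) o} := by
  have h := measurable_from_prod_countable_right
    (f := fun x : (κ → Finset ι) × (((κ × ι → Vec r) × (κ × ι → ℝ)) × (κ × Option ι → ℝ)) =>
      ∃ o, IsStrictBest (Finset.insertNone (x.1 t))
        (linUtility φ ν₀ (fun i => x.2.1.1 (t, i)) fun i => x.2.1.2 (t, i))
        (fun o => x.2.2 (t, o)) o) fun c =>
    Measurable.exists fun o => measurableSet_setOfPred.1 (measurableSet_isStrictBest
      (X := ((κ × ι → Vec r) × (κ × ι → ℝ)) × (κ × Option ι → ℝ)) (s := Finset.insertNone (c t))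
      (u := fun x => linUtility φ ν₀ (fun i => x.1.1 (t, i)) fun i => x.1.2 (t, i))
      (z := fun x o => x.2 (t, o))
      (measurable_linUtility hφ _ (fun i => by fun_prop) fun i => by fun_prop)
      (fun o => by fun_prop) o)
  exact measurableSet_setOfPred.2 (h.comp MeasurableEquiv.prodAssoc.measurable)

section Concentration

variable {r d : ℕ} {ι Ω : Type*} [MeasurableSpace Ω] {P : Measure Ω} {W L₀ cmin : ℝ}
  {φ : Vec r → Vec d} {D : Measure (Vec r)} {ν₀ : Param d} {S : SalesData Ω ι r} {N : ℕ} {m : ℝ}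
  {ψ : ℝ → ℝ} {k : ℕ}

theorem abs_secondMoment_le (hM : IsMarket W L₀ cmin φ D ν₀) (j l : Fin d) :
    |secondMoment φ D j l| ≤ 1 := by
  have := hM.isProbabilityMeasure
  have h := norm_integral_le_of_norm_le_const (μ := D) (f := fun x => φ x j * φ x l) (C := 1) (by
    filter_upwards [hM.feature_bound] with x hx
    rw [Real.norm_eq_abs, abs_mul]
    exact mul_le_one₀ (hx j) (abs_nonneg _) (hx l))
  rw [probReal_univ, mul_one] at h
  exact h

namespace SalesData.IsExploration

theorem ae_feature_bound [Countable ι] (hE : S.IsExploration P N m ψ φ D ν₀ k)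
    (hM : IsMarket W L₀ cmin φ D ν₀) :
    ∀ᵐ ω ∂P, ∀ (t : explorationPeriods d k) (i : ι) (j : Fin d), |φ (S.feature t i ω) j| ≤ 1 := by
  rw [ae_all_iff]
  intro t
  rw [ae_all_iff]
  intro i
  refine ae_of_ae_map (hE.measurable_feature t t.2 i).aemeasurable (p := fun x => ∀ j, |φ x j| ≤ 1) ?_
  rw [hE.law_feature t t.2 i]
  exact hM.feature_bound

theorem ae_price_mem [Countable ι] (hE : S.IsExploration P N m ψ φ D ν₀ k) :
    ∀ᵐ ω ∂P, ∀ (t : explorationPeriods d k) (i : ι), S.price t i ω ∈ Set.Icc (0 : ℝ) 1 := by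
  rw [ae_all_iff]
  intro t
  rw [ae_all_iff]
  intro i
  refine ae_of_ae_map (hE.measurable_price t t.2 i).aemeasurable ?_
  rw [hE.law_price t t.2 i]
  exact ae_restrict_mem measurableSet_Icc

theorem measurable_features (hE : S.IsExploration P N m ψ φ D ν₀ k) :
    Measurable fun ω (s : explorationPeriods d k × ι) => S.feature s.1 s.2 ω :=
  measurable_pi_lambda _ fun s => hE.measurable_feature s.1 s.1.2 s.2

theorem measurable_prices (hE : S.IsExploration P N m ψ φ D ν₀ k) :
    Measurable fun ω (s : explorationPeriods d k × ι) => S.price s.1 s.2 ω :=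
  measurable_pi_lambda _ fun s => hE.measurable_price s.1 s.1.2 s.2

theorem measurable_shocks (hE : S.IsExploration P N m ψ φ D ν₀ k) :
    Measurable fun ω (s : explorationPeriods d k × Option ι) => S.shock s.1 s.2 ω :=
  measurable_pi_lambda _ fun s => hE.measurable_shock s.1 s.1.2 s.2

theorem measurable_considerations (hE : S.IsExploration P N m ψ φ D ν₀ k) :
    Measurable fun ω (t : explorationPeriods d k) => S.consideration t ω :=
  measurable_pi_lambda _ fun t => hE.measurable_consideration t t.2

theorem iIndepFun_shock (hE : S.IsExploration P N m ψ φ D ν₀ k) (t : explorationPeriods d k) :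
    iIndepFun (fun o => S.shock t o) P := by
  have h : Function.Injective fun o : Option ι => (t, o) := fun _ _ h => (Prod.mk.inj h).2
  exact iIndepFun.precomp (f := fun (s : explorationPeriods d k × Option ι) ω => S.shock s.1 s.2 ω)
    h hE.indep_shocks

variable [IsProbabilityMeasure P]

/-- Given the consideration sets, the picked product of each period is a fixed label, so the picked
features are independent with law D. -/
theorem measure_feature_deviation_le [Countable ι] [Nonempty ι]
    (hE : S.IsExploration P N m ψ φ D ν₀ k)
    (hM : IsMarket W L₀ cmin φ D ν₀) (j l : Fin d) {ε : ℝ} (hε : 0 ≤ ε) :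
    P {ω | Fintype.card (explorationPeriods d k) * ε ≤ |∑ t : explorationPeriods d k,
        (φ (S.feature t (pick (S.consideration t ω)) ω) j *
          φ (S.feature t (pick (S.consideration t ω)) ω) l - secondMoment φ D j l)|} ≤
      ENNReal.ofReal (2 * Real.exp (-(Fintype.card (explorationPeriods d k) * ε ^ 2 / 8))) := by
  have := hM.isProbabilityMeasure
  have hφ := hM.measurable_featureMap
  have hg : Measurable fun v : Vec r => φ v j * φ v l - secondMoment φ D j l := by fun_prop
  have hb : ∀ᵐ v ∂D, φ v j * φ v l ∈ Set.Icc (-1 : ℝ) 1 := by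
    filter_upwards [hM.feature_bound] with v hv
    rw [Set.mem_Icc, ← abs_le, abs_mul]
    exact mul_le_one₀ (hv j) (abs_nonneg _) (hv l)
  refine measure_abs_sum_ge_le_of_indepFun (A := fun ω (t : explorationPeriods d k) =>
    S.consideration t ω) (B := fun ω (s : explorationPeriods d k × ι) => S.feature s.1 s.2 ω)
    hE.measurable_considerations hE.measurable_features
    (hE.indep_consideration_rest.comp measurable_id measurable_fst)
    (f := fun t x => φ (x.2 (t, pick (x.1 t))) j * φ (x.2 (t, pick (x.1 t))) l -
      secondMoment φ D j l) ?_ ?_ ?_ ?_ hε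
  · exact fun t => measurable_from_prod_countable_right fun c =>
      hg.comp (measurable_pi_apply (t, pick (c t)))
  · exact fun ω' => (hE.indep_features.precomp
      (g := fun t : explorationPeriods d k => (t, pick (S.consideration t ω')))
      fun _ _ h => (Prod.mk.inj h).1).comp
        (fun _ v => φ v j * φ v l - secondMoment φ D j l) fun _ => hg
  · refine Filter.Eventually.of_forall fun ω' t => ?_
    filter_upwards [hE.ae_feature_bound hM] with ω hω
    have h1 := abs_secondMoment_le hM j l
    have h2 : |φ (S.feature t (pick (S.consideration t ω')) ω) j *
        φ (S.feature t (pick (S.consideration t ω')) ω) l| ≤ 1 := by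
      rw [abs_mul]
      exact mul_le_one₀ (hω t _ j) (abs_nonneg _) (hω t _ l)
    rw [abs_le] at h1 h2
    exact ⟨by linarith [h1.2, h2.1], by linarith [h1.1, h2.2]⟩
  · intro ω' t
    have h1 : ∫ v, (φ v j * φ v l - secondMoment φ D j l) ∂D = 0 := by
      rw [integral_sub (Integrable.of_mem_Icc (-1) 1 (by fun_prop) hb) (integrable_const _)]
      simp [secondMoment]
    have h2 := integral_map (hE.measurable_feature t t.2 (pick (S.consideration t ω'))).aemeasurable
      (hg.aestronglyMeasurable (μ := P.map (S.feature t (pick (S.consideration t ω')))))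
    rw [hE.law_feature t t.2] at h2
    exact h2.symm.trans h1

theorem indepFun_considerations_features_prices (hE : S.IsExploration P N m ψ φ D ν₀ k) :
    IndepFun (fun ω => ((fun t : explorationPeriods d k => S.consideration t ω),
        fun s : explorationPeriods d k × ι => S.feature s.1 s.2 ω))
      (fun ω (s : explorationPeriods d k × ι) => S.price s.1 s.2 ω) P :=
  indepFun_prodMk_left_of_indepFun hE.measurable_considerations hE.measurable_features
    hE.measurable_prices
    (hE.indep_consideration_rest.comp measurable_id
      (measurable_fst.prodMk (measurable_fst.comp measurable_snd)))
    (hE.indep_feature_rest.comp measurable_id measurable_fst)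

theorem indepFun_considerations_features_prices_shocks
    (hE : S.IsExploration P N m ψ φ D ν₀ k) :
    IndepFun (fun ω => ((fun t : explorationPeriods d k => S.consideration t ω),
        ((fun s : explorationPeriods d k × ι => S.feature s.1 s.2 ω),
          fun s : explorationPeriods d k × ι => S.price s.1 s.2 ω)))
      (fun ω (s : explorationPeriods d k × Option ι) => S.shock s.1 s.2 ω) P :=
  indepFun_prodMk_left_of_indepFun hE.measurable_considerations
    (hE.measurable_features.prodMk hE.measurable_prices) hE.measurable_shocks
    (hE.indep_consideration_rest.comp measurable_id
      ((measurable_fst.prodMk (measurable_fst.comp measurable_snd)).prodMk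
        (measurable_snd.comp measurable_snd)))
    (indepFun_prodMk_left_of_indepFun hE.measurable_features hE.measurable_prices
      hE.measurable_shocks hE.indep_feature_rest hE.indep_price_shock)

/-- Given the consideration sets and the features, only the prices remain random, and g is centred
under the uniform law. It serves for g(p) = p - 1/2 and g(p) = p² - 1/3. -/
theorem measure_price_deviation_le [Countable ι] [Nonempty ι]
    (hE : S.IsExploration P N m ψ φ D ν₀ k)
    (hM : IsMarket W L₀ cmin φ D ν₀) (j l : Fin d) {g : ℝ → ℝ} (hg : Measurable g)
    (hg1 : ∀ p ∈ Set.Icc (0 : ℝ) 1, |g p| ≤ 1) (hg0 : ∫ p in Set.Icc (0 : ℝ) 1, g p = 0)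
    {ε : ℝ} (hε : 0 ≤ ε) :
    P {ω | Fintype.card (explorationPeriods d k) * ε ≤ |∑ t : explorationPeriods d k,
        φ (S.feature t (pick (S.consideration t ω)) ω) j *
          φ (S.feature t (pick (S.consideration t ω)) ω) l *
          g (S.price t (pick (S.consideration t ω)) ω)|} ≤
      ENNReal.ofReal (2 * Real.exp (-(Fintype.card (explorationPeriods d k) * ε ^ 2 / 8))) := by
  have hφ := hM.measurable_featureMap
  refine measure_abs_sum_ge_le_of_indepFun
    (A := fun ω => ((fun t : explorationPeriods d k => S.consideration t ω),
        fun s : explorationPeriods d k × ι => S.feature s.1 s.2 ω))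
    (B := fun ω (s : explorationPeriods d k × ι) => S.price s.1 s.2 ω)
    (hE.measurable_considerations.prodMk hE.measurable_features) hE.measurable_prices
    hE.indepFun_considerations_features_prices
    (f := fun t x => φ (x.1.2 (t, pick (x.1.1 t))) j * φ (x.1.2 (t, pick (x.1.1 t))) l *
      g (x.2 (t, pick (x.1.1 t)))) ?_ ?_ ?_ ?_ hε
  · intro t
    have h := measurable_from_prod_countable_right
      (f := fun x : (explorationPeriods d k → Finset ι) ×
          ((explorationPeriods d k × ι → Vec r) × (explorationPeriods d k × ι → ℝ)) =>
        φ (x.2.1 (t, pick (x.1 t))) j * φ (x.2.1 (t, pick (x.1 t))) l *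
          g (x.2.2 (t, pick (x.1 t)))) fun c => by dsimp only; fun_prop
    exact h.comp MeasurableEquiv.prodAssoc.measurable
  · exact fun ω' => (hE.indep_prices.precomp
      (g := fun t : explorationPeriods d k => (t, pick (S.consideration t ω')))
      fun _ _ h => (Prod.mk.inj h).1).comp
        (fun t p => φ (S.feature t (pick (S.consideration t ω')) ω') j *
          φ (S.feature t (pick (S.consideration t ω')) ω') l * g p) fun _ => hg.const_mul _
  · filter_upwards [hE.ae_feature_bound hM] with ω' hω' t
    filter_upwards [hE.ae_price_mem] with ω hω
    rw [Set.mem_Icc, ← abs_le, abs_mul, abs_mul]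
    refine (mul_le_one₀ (mul_le_one₀ (hω' t _ j) (abs_nonneg _) (hω' t _ l)) (abs_nonneg _)
      (hg1 _ (hω t _))).trans (by norm_num)
  · intro ω' t
    rw [← hE.law_price t t.2 (pick (S.consideration t ω')),
      integral_map (hE.measurable_price t t.2 _).aemeasurable hg.aestronglyMeasurable] at hg0
    simp only
    rw [integral_const_mul, hg0, mul_zero]

/-- Everything except the shocks is frozen. The scores of different periods then depend on disjoint
groups of shocks, and ‖μ‖₁ ≤ 1 bounds the utilities in direction μ by one. -/
theorem measure_score_deviation_le [Countable ι] (hE : S.IsExploration P N m ψ φ D ν₀ k)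
    (hM : IsMarket W L₀ cmin φ D ν₀) {μ : Param d} (hμ : l1Norm μ ≤ 1) {ε : ℝ} (hε : 0 ≤ ε) :
    P {ω | Fintype.card (explorationPeriods d k) * ε ≤ |∑ t : explorationPeriods d k,
        score (S.options t ω) (S.baseUtility φ ν₀ t ω) (S.shock t · ω) (S.baseUtility φ μ t ω)|} ≤
      ENNReal.ofReal (2 * Real.exp (-(Fintype.card (explorationPeriods d k) * ε ^ 2 / 8))) := by
  have hφ := hM.measurable_featureMap
  have hbase : ∀ (ν : Param d) t ω, S.baseUtility φ ν t ω =
      linUtility φ ν (S.feature t · ω) (S.price t · ω) := fun ν t ω => by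
    ext o; exact S.baseUtility_eq φ ν t ω o
  simp only [hbase]
  refine measure_abs_sum_ge_le_of_indepFun
    (A := fun ω => ((fun t : explorationPeriods d k => S.consideration t ω),
        ((fun s : explorationPeriods d k × ι => S.feature s.1 s.2 ω),
          fun s : explorationPeriods d k × ι => S.price s.1 s.2 ω)))
    (B := fun ω (s : explorationPeriods d k × Option ι) => S.shock s.1 s.2 ω)
    (hE.measurable_considerations.prodMk (hE.measurable_features.prodMk hE.measurable_prices))
    hE.measurable_shocks hE.indepFun_considerations_features_prices_shocks
    (f := periodScore φ ν₀ μ) (measurable_periodScore hφ ν₀ μ) ?_ ?_ ?_ hε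
  · exact fun ω' => (iIndepFun_curry
      (X := fun (s : explorationPeriods d k × Option ι) ω => S.shock s.1 s.2 ω)
      (fun s => hE.measurable_shock s.1 s.1.2 s.2)
      hE.indep_shocks).comp (fun t z => score (Finset.insertNone (S.consideration t ω'))
        (linUtility φ ν₀ (S.feature t · ω') (S.price t · ω')) z
        (linUtility φ μ (S.feature t · ω') (S.price t · ω')))
        fun t => measurable_score _ (fun _ => measurable_const) measurable_pi_apply
          fun _ => measurable_const
  · filter_upwards [hE.ae_feature_bound hM, hE.ae_price_mem] with ω' hx hp t
    refine Filter.Eventually.of_forall fun ω => ?_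
    rw [Set.mem_Icc, ← abs_le]
    exact abs_score_le ⟨none, Finset.none_mem_insertNone⟩ fun o _ =>
      (abs_linUtility_le μ (fun i _ => hx t i) fun i _ => hp t i).trans hμ
  · intro ω' t
    have hne : (Finset.insertNone (S.consideration t ω')).Nonempty :=
      ⟨none, Finset.none_mem_insertNone⟩
    have h := integral_score (hE.measurable_shock t t.2) (hE.iIndepFun_shock t)
      (hE.law_shock t t.2) hne (linUtility φ ν₀ (S.feature t · ω') (S.price t · ω'))
      (linUtility φ μ (S.feature t · ω') (S.price t · ω'))
    simpa only [periodScore] using h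

/-- Almost surely the choice is the unique utility maximizer in all exploration periods. -/
theorem ae_isStrictBest_choice [Countable ι] (hE : S.IsExploration P N m ψ φ D ν₀ k)
    (hM : IsMarket W L₀ cmin φ D ν₀) (hψ : StrictMono ψ) :
    ∀ᵐ ω ∂P, ∀ t : explorationPeriods d k, IsStrictBest (S.options t ω)
      (S.baseUtility φ ν₀ t ω) (S.shock t · ω) (S.choice t ω) := by
  have hφ := hM.measurable_featureMap
  have hbase : ∀ t ω, S.baseUtility φ ν₀ t ω =
      linUtility φ ν₀ (S.feature t · ω) (S.price t · ω) := fun t ω => by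
    ext o; exact S.baseUtility_eq φ ν₀ t ω o
  rw [ae_all_iff]
  intro t
  have key : ∀ᵐ ω ∂P, ∃ o : Option ι, IsStrictBest (S.options t ω)
      (S.baseUtility φ ν₀ t ω) (S.shock t · ω) o := by
    simp only [hbase]
    refine ae_of_indepFun
      (A := fun ω => ((fun t : explorationPeriods d k => S.consideration t ω),
        ((fun s : explorationPeriods d k × ι => S.feature s.1 s.2 ω),
          fun s : explorationPeriods d k × ι => S.price s.1 s.2 ω)))
      (B := fun ω (s : explorationPeriods d k × Option ι) => S.shock s.1 s.2 ω)
      (hE.measurable_considerations.prodMk (hE.measurable_features.prodMk hE.measurable_prices))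
      hE.measurable_shocks hE.indepFun_considerations_features_prices_shocks
      (s := {y | ∃ o, IsStrictBest (Finset.insertNone (y.1.1 t))
        (linUtility φ ν₀ (fun i => y.1.2.1 (t, i)) fun i => y.1.2.2 (t, i))
        (fun o => y.2 (t, o)) o}) (measurableSet_exists_isStrictBest hφ ν₀ t) ?_
    · refine Filter.Eventually.of_forall fun ω' => ?_
      have hne : (S.options t ω').Nonempty := ⟨none, Finset.none_mem_insertNone⟩
      have h := ae_exists_isStrictBest (hE.measurable_shock t t.2) (hE.iIndepFun_shock t)
        (hE.law_shock t t.2) hne (linUtility φ ν₀ (S.feature t · ω') (S.price t · ω'))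
      filter_upwards [h] with ω hω
      obtain ⟨o, _, ho⟩ := hω
      exact ⟨o, ho⟩
  filter_upwards [key] with ω hω
  obtain ⟨o, ho⟩ := hω
  -- A different choice would have strictly smaller perturbed utility, hence strictly smaller
  -- utility since ψ is strictly increasing.
  have : S.choice t ω = o := by
    by_contra hne
    exact absurd (hE.choice_max t t.2 ω o ho.1)
      (not_le.2 (hψ (ho.2 _ (hE.choice_mem t t.2 ω) hne)))
  rwa [this]

end SalesData.IsExploration

end Concentration

/-! ### Deterministic error bound -/

section Deterministic

variable {r d : ℕ} {ι : Type*}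

theorem score_eq_sum {O : Type*} (s : Finset O) (u z w : O → ℝ) :
    score s u z w =
      ∑ o ∈ s, (softmax s u o - Set.indicator {o | IsStrictBest s u z o} 1 o) * w o := by
  classical
  rw [score, ← Finset.sum_sub_distrib]
  refine Finset.sum_congr rfl fun o _ => ?_
  rw [sub_mul, Set.indicator_apply, Set.indicator_apply]
  split_ifs <;> simp

theorem score_sum {O J : Type*} (s : Finset O) (u z : O → ℝ) (J' : Finset J) (a : J → ℝ)
    (w : J → O → ℝ) :
    score s u z (fun o => ∑ j ∈ J', a j * w j o) = ∑ j ∈ J', a j * score s u z (w j) := by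
  simp only [score_eq_sum, Finset.mul_sum]
  rw [Finset.sum_comm]
  refine Finset.sum_congr rfl fun j _ => Finset.sum_congr rfl fun o _ => ?_
  ring

theorem score_add {O : Type*} (s : Finset O) (u z w w' : O → ℝ) :
    score s u z (fun o => w o + w' o) = score s u z w + score s u z w' := by
  simp only [score_eq_sum, mul_add, Finset.sum_add_distrib]

theorem linUtility_sub (φ : Vec r → Vec d) (ν ν' : Param d) (x : ι → Vec r) (p : ι → ℝ)
    (o : Option ι) :
    linUtility φ (ν - ν') x p o = linUtility φ ν x p o - linUtility φ ν' x p o := by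
  cases o with
  | none => simp [linUtility]
  | some i =>
    simp only [linUtility, Prod.fst_sub, Prod.snd_sub, inner_sub_right]
    ring

/-- By linearity, the score in a random direction is controlled by the scores in the 2d coordinate
directions. -/
theorem linUtility_eq_sum (φ : Vec r → Vec d) (ν : Param d) (x : ι → Vec r) (p : ι → ℝ)
    (o : Option ι) :
    linUtility φ ν x p o =
      ∑ j, ν.1 j * linUtility φ (EuclideanSpace.single j 1, 0) x p o +
        ∑ j, ν.2 j * linUtility φ (0, EuclideanSpace.single j 1) x p o := by
  cases o with
  | none => simp [linUtility]
  | some i =>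
    simp only [linUtility, inner_zero_right, zero_mul,
      EuclideanSpace.inner_single_right, conj_trivial, one_mul, inner_eq_sum, Finset.sum_mul,
      sub_eq_add_neg, ← Finset.sum_neg_distrib]
    congr 1 <;> refine Finset.sum_congr rfl fun j _ => by ring

theorem l1Norm_single_fst (j : Fin d) :
    l1Norm ((EuclideanSpace.single j 1, 0) : Param d) = 1 := by
  classical
  simp [l1Norm, apply_ite abs]

theorem l1Norm_single_snd (j : Fin d) :
    l1Norm ((0, EuclideanSpace.single j 1) : Param d) = 1 := by
  classical
  simp [l1Norm, apply_ite abs]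

/-- Duality of the ℓ₁ and sup norms: entrywise control of a matrix suffices, at the price of ℓ₁
norms, which the constraint keeps bounded. -/
theorem abs_bilin_le {M : Fin d → Fin d → ℝ} {K : ℝ} (hM : ∀ j l, |M j l| ≤ K) (a b : Fin d → ℝ) :
    |∑ j, ∑ l, a j * b l * M j l| ≤ K * (∑ j, |a j|) * ∑ l, |b l| := by
  calc |∑ j, ∑ l, a j * b l * M j l| ≤ ∑ j, ∑ l, |a j * b l * M j l| :=
        (Finset.abs_sum_le_sum_abs _ _).trans
          (Finset.sum_le_sum fun j _ => Finset.abs_sum_le_sum_abs _ _)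
    _ ≤ ∑ j, ∑ l, |a j| * |b l| * K := by
        refine Finset.sum_le_sum fun j _ => Finset.sum_le_sum fun l _ => ?_
        rw [abs_mul, abs_mul]
        exact mul_le_mul_of_nonneg_left (hM j l) (by positivity)
    _ = _ := by
        rw [mul_assoc, Finset.sum_mul_sum, Finset.mul_sum]
        refine Finset.sum_congr rfl fun j _ => ?_
        rw [Finset.mul_sum]
        exact Finset.sum_congr rfl fun l _ => by ring

theorem sum_inner_mul_inner {κ : Type*} [Fintype κ] (x : κ → Vec d) (g : κ → ℝ) (a b : Vec d) :
    ∑ t, inner ℝ (x t) a * inner ℝ (x t) b * g t =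
      ∑ j, ∑ l, a j * b l * ∑ t, x t j * x t l * g t := by
  have h : ∀ t, inner ℝ (x t) a * inner ℝ (x t) b * g t =
      ∑ j, ∑ l, a j * b l * (x t j * x t l * g t) := fun t => by
    rw [inner_eq_sum, inner_eq_sum, Finset.sum_mul_sum, Finset.sum_mul]
    refine Finset.sum_congr rfl fun j _ => ?_
    rw [Finset.sum_mul]
    exact Finset.sum_congr rfl fun l _ => by ring
  simp only [h, Finset.mul_sum]
  rw [Finset.sum_comm]
  refine Finset.sum_congr rfl fun j _ => ?_
  rw [Finset.sum_comm]

theorem abs_sum_inner_mul_inner_le {κ : Type*} [Fintype κ] (x : κ → Vec d) (g : κ → ℝ) {K : ℝ}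
    (h : ∀ j l, |∑ t, x t j * x t l * g t| ≤ K) (a b : Vec d) :
    |∑ t, inner ℝ (x t) a * inner ℝ (x t) b * g t| ≤ K * (∑ j, |a j|) * ∑ l, |b l| := by
  rw [sum_inner_mul_inner]
  exact abs_bilin_le h a b

theorem sum_inner_sq_ge {κ : Type*} [Fintype κ] (x : κ → Vec d) (Q : Matrix (Fin d) (Fin d) ℝ)
    {K : ℝ} (h : ∀ j l, |∑ t, (x t j * x t l - Q j l)| ≤ K) (a : Vec d) :
    Fintype.card κ * (a ⬝ᵥ Q.mulVec a) - K * (∑ j, |a j|) ^ 2 ≤ ∑ t, inner ℝ (x t) a ^ 2 := by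
  have h1 := abs_bilin_le h a a
  have h2 : ∑ j, ∑ l, a j * a l * ∑ t, (x t j * x t l - Q j l) =
      ∑ t, inner ℝ (x t) a ^ 2 - Fintype.card κ * (a ⬝ᵥ Q.mulVec a) := by
    have e1 : ∑ t, inner ℝ (x t) a ^ 2 = ∑ j, ∑ l, a j * a l * ∑ t, x t j * x t l := by
      simpa [sq] using sum_inner_mul_inner x (fun _ => 1) a a
    have e2 : Fintype.card κ * (a ⬝ᵥ Q.mulVec a) =
        ∑ j, ∑ l, a j * a l * (Fintype.card κ * Q j l) := by
      simp only [dotProduct, Matrix.mulVec, Finset.mul_sum]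
      exact Finset.sum_congr rfl fun j _ => Finset.sum_congr rfl fun l _ => by ring
    rw [e1, e2, ← Finset.sum_sub_distrib]
    refine Finset.sum_congr rfl fun j _ => ?_
    rw [← Finset.sum_sub_distrib]
    refine Finset.sum_congr rfl fun l _ => ?_
    rw [Finset.sum_sub_distrib, Finset.sum_const, Finset.card_univ, nsmul_eq_mul]
    ring
  rw [h2] at h1
  nlinarith [(abs_le.1 h1).1]

/-- Lower bound for the empirical second moment of the utility differences. -/
theorem sum_utility_sq_ge {κ : Type*} [Fintype κ] (x : κ → Vec d) (p : κ → ℝ)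
    (Q : Matrix (Fin d) (Fin d) ℝ) {K cmin : ℝ} (hK : 0 ≤ K)
    (hQ : ∀ v : Vec d, cmin * ‖v‖ ^ 2 ≤ v ⬝ᵥ Q.mulVec v)
    (h1 : ∀ j l, |∑ t, (x t j * x t l - Q j l)| ≤ K)
    (h2 : ∀ j l, |∑ t, x t j * x t l * (p t - 1 / 2)| ≤ K)
    (h3 : ∀ j l, |∑ t, x t j * x t l * (p t ^ 2 - 1 / 3)| ≤ K) (ν : Param d) :
    Fintype.card κ * cmin / 16 * (‖ν.1‖ ^ 2 + ‖ν.2‖ ^ 2) - 2 * K * l1Norm ν ^ 2 ≤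
      ∑ t, (inner ℝ (x t) ν.1 - inner ℝ (x t) ν.2 * p t) ^ 2 := by
  obtain ⟨a, b⟩ := ν
  simp only [l1Norm]
  have ha := sum_inner_sq_ge x Q h1 a
  have hb := sum_inner_sq_ge x Q h1 b
  have h2' := abs_sum_inner_mul_inner_le x _ h2 a b
  have h3' := abs_sum_inner_mul_inner_le x _ h3 b b
  have hqa := mul_le_mul_of_nonneg_left (hQ a) (Nat.cast_nonneg (α := ℝ) (Fintype.card κ))
  have hqb := mul_le_mul_of_nonneg_left (hQ b) (Nat.cast_nonneg (α := ℝ) (Fintype.card κ))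
  have hA : 0 ≤ ∑ j, |a j| := Finset.sum_nonneg fun _ _ => abs_nonneg _
  have hB : 0 ≤ ∑ j, |b j| := Finset.sum_nonneg fun _ _ => abs_nonneg _
  -- Centring p at 1/2 and p² at 1/3 leaves the form α² - αβ + β²/3, the mean of (α - βp)² over
  -- uniform p. It dominates (α² + β²)/16: the difference is 15/16 · (α - 8β/15)² + β²/240.
  have key : (∑ t, inner ℝ (x t) a ^ 2) / 16 + (∑ t, inner ℝ (x t) b ^ 2) / 16
      - 2 * (∑ t, inner ℝ (x t) a * inner ℝ (x t) b * (p t - 1 / 2))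
      + ∑ t, inner ℝ (x t) b * inner ℝ (x t) b * (p t ^ 2 - 1 / 3) ≤
      ∑ t, (inner ℝ (x t) a - inner ℝ (x t) b * p t) ^ 2 := by
    rw [Finset.sum_div, Finset.sum_div, Finset.mul_sum, ← Finset.sum_add_distrib,
      ← Finset.sum_sub_distrib, ← Finset.sum_add_distrib]
    refine Finset.sum_le_sum fun t _ => ?_
    generalize (inner ℝ (x t) a : ℝ) = α
    generalize (inner ℝ (x t) b : ℝ) = β
    nlinarith [sq_nonneg (α - 8 / 15 * β), sq_nonneg β]
  have h2'' := (abs_le.1 h2').2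
  have h3'' := (abs_le.1 h3').1
  set A := ∑ j, |a j|
  set B := ∑ j, |b j|
  have hKA : 0 ≤ K * A ^ 2 := by positivity
  have hKAB : 0 ≤ K * A * B := by positivity
  have hKB : 0 ≤ K * B ^ 2 := by positivity
  simp only at *
  nlinarith

/-- Cauchy-Schwarz in dimension 2d. This factor d turns the squared deviation level log(kd)/(kd)
into the rate log(kd)/k. -/
theorem l1Norm_sq_le (ν : Param d) :
    l1Norm ν ^ 2 ≤ 2 * d * (‖ν.1‖ ^ 2 + ‖ν.2‖ ^ 2) := by
  have h : ∀ a : Vec d, (∑ j, |a j|) ^ 2 ≤ d * ‖a‖ ^ 2 := fun a => by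
    have := sq_sum_le_card_mul_sum_sq (s := Finset.univ) (f := fun j => |a j|)
    rw [EuclideanSpace.norm_sq_eq]
    simpa using this
  have h1 := h ν.1
  have h2 := h ν.2
  unfold l1Norm
  nlinarith [sq_nonneg (∑ j, |ν.1 j| - ∑ j, |ν.2 j|)]

theorem l1Norm_sub_le (ν ν' : Param d) : l1Norm (ν - ν') ≤ l1Norm ν + l1Norm ν' := by
  unfold l1Norm
  have h : ∀ a b : Vec d, ∑ j, |(a - b) j| ≤ ∑ j, |a j| + ∑ j, |b j| := fun a b => by
    rw [← Finset.sum_add_distrib]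
    exact Finset.sum_le_sum fun j _ => abs_sub _ _
  have h1 := h ν.1 ν'.1
  have h2 := h ν.2 ν'.2
  simp only [Prod.fst_sub, Prod.snd_sub]
  linarith

theorem l1Norm_nonneg (ν : Param d) : 0 ≤ l1Norm ν := by
  unfold l1Norm
  positivity

/-- The basic inequality for a constrained maximum-likelihood estimate. -/
theorem SalesData.IsConstrainedMLE.basic_inequality [Nonempty ι] {Ω : Type*}
    {S : SalesData Ω ι r} {φ : Vec r → Vec d}
    {W K cmin : ℝ} {N k : ℕ} {ω : Ω} {ν₀ ν : Param d} {Q : Matrix (Fin d) (Fin d) ℝ}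
    (hkd : 0 < k * d) (hMLE : S.IsConstrainedMLE φ W k ω ν) (hν₀ : l1Norm ν₀ ≤ W) (hK : 0 ≤ K)
    (hQ : ∀ v : Vec d, cmin * ‖v‖ ^ 2 ≤ v ⬝ᵥ Q.mulVec v)
    (hne : ∀ t : explorationPeriods d k, (S.consideration t ω).Nonempty)
    (hcard : ∀ t : explorationPeriods d k, (S.consideration t ω).card ≤ N)
    (hx : ∀ (t : explorationPeriods d k) (i : ι) (j : Fin d), |φ (S.feature t i ω) j| ≤ 1)
    (hp : ∀ (t : explorationPeriods d k) (i : ι), S.price t i ω ∈ Set.Icc (0 : ℝ) 1)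
    (hbest : ∀ t : explorationPeriods d k, IsStrictBest (S.options t ω)
      (S.baseUtility φ ν₀ t ω) (S.shock t · ω) (S.choice t ω))
    (h1 : ∀ j l, |∑ t : explorationPeriods d k,
      (φ (S.feature t (pick (S.consideration t ω)) ω) j *
        φ (S.feature t (pick (S.consideration t ω)) ω) l - Q j l)| ≤ K)
    (h2 : ∀ j l, |∑ t : explorationPeriods d k,
      φ (S.feature t (pick (S.consideration t ω)) ω) j *
        φ (S.feature t (pick (S.consideration t ω)) ω) l *
        (S.price t (pick (S.consideration t ω)) ω - 1 / 2)| ≤ K)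
    (h3 : ∀ j l, |∑ t : explorationPeriods d k,
      φ (S.feature t (pick (S.consideration t ω)) ω) j *
        φ (S.feature t (pick (S.consideration t ω)) ω) l *
        (S.price t (pick (S.consideration t ω)) ω ^ 2 - 1 / 3)| ≤ K)
    (h4 : ∀ j, |∑ t : explorationPeriods d k, score (S.options t ω) (S.baseUtility φ ν₀ t ω)
      (S.shock t · ω) (S.baseUtility φ (EuclideanSpace.single j 1, 0) t ω)| ≤ K)
    (h5 : ∀ j, |∑ t : explorationPeriods d k, score (S.options t ω) (S.baseUtility φ ν₀ t ω)
      (S.shock t · ω) (S.baseUtility φ (0, EuclideanSpace.single j 1) t ω)| ≤ K) :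
    curvature W N * (((k * d : ℕ) : ℝ) * cmin / 16 * (‖(ν - ν₀).1‖ ^ 2 + ‖(ν - ν₀).2‖ ^ 2)) ≤
      K * l1Norm (ν - ν₀) + curvature W N * (2 * K * l1Norm (ν - ν₀) ^ 2) := by
  have hbase : ∀ (ν : Param d) (t : ℕ), S.baseUtility φ ν t ω =
      linUtility φ ν (S.feature t · ω) (S.price t · ω) := fun ν t => by
    ext o; exact S.baseUtility_eq φ ν t ω o
  have hbnd : ∀ (ν' : Param d), l1Norm ν' ≤ W → ∀ (t : explorationPeriods d k) (o : Option ι),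
      |S.baseUtility φ ν' t ω o| ≤ W := fun ν' hν' t o => by
    rw [hbase]
    exact (abs_linUtility_le ν' (fun i _ => hx t i) fun i _ => hp t i).trans hν'
  have hW : 0 ≤ W := (l1Norm_nonneg ν₀).trans hν₀
  set δ := ν - ν₀ with hδ
  have hdiff : ∀ (t : ℕ) (o : Option ι), S.baseUtility φ ν t ω o - S.baseUtility φ ν₀ t ω o =
      S.baseUtility φ δ t ω o := fun t o => by
    rw [hbase, hbase, hbase, hδ, linUtility_sub]
  -- The recorded choice is the strict maximizer here, so the first-order term of
  -- `log_softmax_sub_ge` is the score; the curvature is spent on the picked product alone.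
  have hstep : ∀ t : explorationPeriods d k,
      score (S.options t ω) (S.baseUtility φ ν₀ t ω) (S.shock t · ω) (S.baseUtility φ δ t ω) +
        curvature W N * S.baseUtility φ δ t ω (some (pick (S.consideration t ω))) ^ 2 ≤
      Real.log (softmax (S.options t ω) (S.baseUtility φ ν₀ t ω) (S.choice t ω)) -
        Real.log (softmax (S.options t ω) (S.baseUtility φ ν t ω) (S.choice t ω)) := fun t => by
    have hc : (S.options t ω).card ≤ N + 1 := by
      rw [SalesData.options, Finset.card_insertNone]
      exact Nat.add_le_add_right (hcard t) 1
    have h := log_softmax_sub_ge (s := S.options t ω) (u := S.baseUtility φ ν₀ t ω)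
      (u' := S.baseUtility φ ν t ω) (W := W) (N := N) (o₀ := none)
      Finset.none_mem_insertNone rfl rfl hc (fun o _ => hbnd ν₀ hν₀ t o)
      (fun o _ => hbnd ν hMLE.1 t o) (i := some (pick (S.consideration t ω)))
      (Finset.some_mem_insertNone.2 (pick_mem (hne t))) (by simp) (S.choice t ω)
    simp only [hdiff] at h
    rwa [score_eq (hbest t)]
  have hsum := Finset.sum_le_sum fun t (_ : t ∈ (Finset.univ : Finset (explorationPeriods d k))) =>
    hstep t
  -- Minimality is used only against the competitor ν₀, which is feasible.
  have hloss : ∑ t : explorationPeriods d k,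
      (Real.log (softmax (S.options t ω) (S.baseUtility φ ν₀ t ω) (S.choice t ω)) -
        Real.log (softmax (S.options t ω) (S.baseUtility φ ν t ω) (S.choice t ω))) ≤ 0 := by
    have h := hMLE.2 ν₀ hν₀
    have hpos : (0 : ℝ) < 1 / ((k : ℝ) * d) := by
      have : (0 : ℝ) < (k : ℝ) * d := by exact_mod_cast hkd
      positivity
    unfold SalesData.loss at h
    rw [neg_mul, neg_mul, neg_le_neg_iff, mul_le_mul_iff_right₀ hpos] at h
    rw [Finset.sum_sub_distrib, sub_nonpos]
    have e : ∀ ν' : Param d, ∑ t : explorationPeriods d k,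
        Real.log (softmax (S.options t ω) (S.baseUtility φ ν' t ω) (S.choice t ω)) =
        ∑ t ∈ explorationPeriods d k, Real.log (Real.exp (S.baseUtility φ ν' t ω (S.choice t ω)) /
          ∑ o ∈ S.options t ω, Real.exp (S.baseUtility φ ν' t ω o)) := fun ν' =>
      Finset.sum_coe_sort (explorationPeriods d k) fun t =>
        Real.log (softmax (S.options t ω) (S.baseUtility φ ν' t ω) (S.choice t ω))
    rw [e, e]
    exact h
  have hscore : -(K * l1Norm δ) ≤ ∑ t : explorationPeriods d k,
      score (S.options t ω) (S.baseUtility φ ν₀ t ω) (S.shock t · ω)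
        (S.baseUtility φ δ t ω) := by
    have e : ∀ t : explorationPeriods d k, score (S.options t ω) (S.baseUtility φ ν₀ t ω)
        (S.shock t · ω) (S.baseUtility φ δ t ω) =
        ∑ j, δ.1 j * score (S.options t ω) (S.baseUtility φ ν₀ t ω) (S.shock t · ω)
            (S.baseUtility φ (EuclideanSpace.single j 1, 0) t ω) +
          ∑ j, δ.2 j * score (S.options t ω) (S.baseUtility φ ν₀ t ω) (S.shock t · ω)
            (S.baseUtility φ (0, EuclideanSpace.single j 1) t ω) := fun t => by
      rw [← score_sum, ← score_sum, ← score_add]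
      congr 1
      ext o
      simp only [hbase]
      exact linUtility_eq_sum φ δ _ _ o
    simp only [e]
    rw [Finset.sum_add_distrib, Finset.sum_comm, Finset.sum_comm (t := Finset.univ (α := Fin d))]
    simp only [← Finset.mul_sum]
    have hlin : ∀ (a f : Fin d → ℝ), (∀ j, |f j| ≤ K) →
        -(K * ∑ j, |a j|) ≤ ∑ j, a j * f j := fun a f hf => by
      rw [Finset.mul_sum, ← Finset.sum_neg_distrib]
      refine Finset.sum_le_sum fun j _ => ?_
      have : |a j * f j| ≤ K * |a j| := by
        rw [abs_mul, mul_comm]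
        exact mul_le_mul_of_nonneg_right (hf j) (abs_nonneg _)
      exact (abs_le.1 this).1
    have e1 := hlin δ.1 _ h4
    have e2 := hlin δ.2 _ h5
    unfold l1Norm
    linarith
  have hquad := sum_utility_sq_ge
    (fun t : explorationPeriods d k => φ (S.feature t (pick (S.consideration t ω)) ω))
    (fun t => S.price t (pick (S.consideration t ω)) ω) Q hK hQ h1 h2 h3 δ
  rw [Fintype.card_coe, card_explorationPeriods] at hquad
  rw [Finset.sum_add_distrib, ← Finset.mul_sum] at hsum
  have hcurv := curvature_pos hW N
  have := mul_le_mul_of_nonneg_left hquad hcurv.le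
  have e3 : ∑ t : explorationPeriods d k,
      S.baseUtility φ δ t ω (some (pick (S.consideration t ω))) ^ 2 =
      ∑ t : explorationPeriods d k,
        (inner ℝ (φ (S.feature t (pick (S.consideration t ω)) ω)) δ.1 -
          inner ℝ (φ (S.feature t (pick (S.consideration t ω)) ω)) δ.2 *
          S.price t (pick (S.consideration t ω)) ω) ^ 2 := rfl
  rw [e3] at hsum
  rw [mul_sub] at this
  linarith

end Deterministic

/-! ### The high-probability error bound -/

theorem integral_price_sub_half : ∫ p in Set.Icc (0 : ℝ) 1, (p - 1 / 2) = 0 := by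
  rw [integral_Icc_eq_integral_Ioc, ← intervalIntegral.integral_of_le zero_le_one,
    intervalIntegral.integral_sub (continuous_id'.intervalIntegrable _ _)
      (continuous_const.intervalIntegrable _ _)]
  norm_num

theorem integral_price_sq_sub_third : ∫ p in Set.Icc (0 : ℝ) 1, (p ^ 2 - 1 / 3) = 0 := by
  rw [integral_Icc_eq_integral_Ioc, ← intervalIntegral.integral_of_le zero_le_one,
    intervalIntegral.integral_sub ((continuous_pow 2).intervalIntegrable _ _)
      (continuous_const.intervalIntegrable _ _)]
  norm_num

/-- The quadratic inequality for the estimation error, solved. -/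
theorem sq_error_le_of_basic_inequality {c cmin n W ε R A : ℝ} {d : ℕ} (hc : 0 < c)
    (hcmin : 0 < cmin) (hn : 0 < n) (hW : 0 ≤ W) (hε : 0 ≤ ε) (hA : 0 ≤ A) (hR : 0 ≤ R)
    (hAW : A ≤ 2 * W) (hAR : A ^ 2 ≤ 2 * d * R)
    (h : c * (n * cmin / 16 * R) ≤ n * ε * A + c * (2 * (n * ε) * A ^ 2)) :
    R ≤ (16 * (1 + 4 * c * W) / (c * cmin)) ^ 2 * (2 * d * ε ^ 2) := by
  set B := 1 + 4 * c * W with hB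
  have hB0 : 0 < B := by positivity
  have h1 : c * cmin * R ≤ 16 * B * ε * A := by
    have h2 : n * (c * cmin * R) ≤ n * (16 * B * ε * A) := by
      -- One of the two factors A in the quadratic error is replaced by its bound 2W, which makes
      -- the right side linear in A and produces B = 1 + 4cW.
      have h3 : c * (n * ε) * A * A ≤ c * (n * ε) * A * (2 * W) :=
        mul_le_mul_of_nonneg_left hAW (by positivity)
      rw [hB]
      nlinarith
    exact le_of_mul_le_mul_left h2 hn
  have h4 : (c * cmin * R) ^ 2 ≤ (16 * B * ε * A) ^ 2 :=
    pow_le_pow_left₀ (by positivity) h1 2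
  have h5 : (16 * B * ε * A) ^ 2 ≤ (16 * B * ε) ^ 2 * (2 * d * R) := by
    rw [mul_pow]
    exact mul_le_mul_of_nonneg_left hAR (sq_nonneg _)
  rcases hR.eq_or_lt with rfl | hR0
  · positivity
  -- After squaring and inserting A² ≤ 2dR, one factor R cancels.
  · have h6 : R * ((c * cmin) ^ 2 * R) ≤ R * ((16 * B) ^ 2 * (2 * d * ε ^ 2)) := by nlinarith
    have h7 := le_of_mul_le_mul_left h6 hR0
    rw [div_pow, div_mul_eq_mul_div, le_div_iff₀ (by positivity)]
    linarith

/-- Outside of an event of small probability, finitely many deviations are small and an almost sure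
property holds. -/
theorem exists_measurableSet_of_measure_le {Ω I : Type*} [Fintype I] [MeasurableSpace Ω]
    {P : Measure Ω} [IsProbabilityMeasure P] {E : I → Set Ω} {q : Ω → Prop} {η : ℝ} (hη : 0 ≤ η)
    (hE : ∀ i, P (E i) ≤ ENNReal.ofReal η) (hq : ∀ᵐ ω ∂P, q ω) :
    ∃ G : Set Ω, MeasurableSet G ∧ 1 - Fintype.card I * η ≤ P.real G ∧
      ∀ ω ∈ G, q ω ∧ ∀ i, ω ∉ E i := by
  set B := (⋃ i, E i) ∪ {ω | ¬q ω} with hB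
  have hPB : P B ≤ ENNReal.ofReal (Fintype.card I * η) := by
    calc P B ≤ P (⋃ i, E i) + P {ω | ¬q ω} := measure_union_le _ _
      _ = P (⋃ i, E i) := by rw [ae_iff.1 hq, add_zero]
      _ ≤ ∑ i, P (E i) := measure_iUnion_fintype_le _ _
      _ ≤ ∑ _i : I, ENNReal.ofReal η := Finset.sum_le_sum fun i _ => hE i
      _ = ENNReal.ofReal (Fintype.card I * η) := by
          rw [Finset.sum_const, Finset.card_univ, nsmul_eq_mul,
            ENNReal.ofReal_mul (Nat.cast_nonneg _), ENNReal.ofReal_natCast]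
  -- B need not be measurable; its measurable hull has the same measure.
  refine ⟨(toMeasurable P B)ᶜ, (measurableSet_toMeasurable P B).compl, ?_, fun ω hω => ?_⟩
  · rw [probReal_compl_eq_one_sub (measurableSet_toMeasurable P B), measureReal_def,
      measure_toMeasurable]
    have := ENNReal.toReal_mono ENNReal.ofReal_ne_top hPB
    rw [ENNReal.toReal_ofReal (by positivity)] at this
    linarith
  · have hωB : ω ∉ B := fun h => hω (subset_toMeasurable P B h)
    rw [hB, Set.mem_union, not_or, Set.mem_iUnion, not_exists] at hωB
    exact ⟨not_not.1 hωB.2, hωB.1⟩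

/-- At most 5d² events of probability at most 2(kd)⁻⁴ give 10 d⁻²k⁻⁴. The condition k ≥ 10 absorbs
the factor 10, and k⁻³ ≤ k^(-1.5). -/
theorem union_bound_le {d k : ℕ} (hd : 1 ≤ d) (hk : 10 ≤ k) :
    ((3 * d ^ 2 + 2 * d : ℕ) : ℝ) * (2 * Real.exp (-(4 * Real.log ((k : ℝ) * d)))) ≤
      (d : ℝ) ^ (-2 : ℝ) * (k : ℝ) ^ (-1.5 : ℝ) := by
  have hd' : (1 : ℝ) ≤ d := by exact_mod_cast hd
  have hk' : (10 : ℝ) ≤ k := by exact_mod_cast hk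
  have hn : 0 < (k : ℝ) * d := by positivity
  have h1 : Real.exp (-(4 * Real.log ((k : ℝ) * d))) = 1 / ((k : ℝ) * d) ^ 4 := by
    rw [Real.exp_neg, show (4 : ℝ) * Real.log (k * d) = ((4 : ℕ) : ℝ) * Real.log (k * d) by norm_num,
      Real.exp_nat_mul, Real.exp_log hn, one_div]
  have h2 : (d : ℝ) ^ (-2 : ℝ) = 1 / (d : ℝ) ^ 2 := by
    rw [Real.rpow_neg (by positivity), one_div]
    norm_num
  have h3 : 1 / (k : ℝ) ^ 3 ≤ (k : ℝ) ^ (-1.5 : ℝ) := by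
    have h : (k : ℝ) ^ (-3 : ℝ) = 1 / (k : ℝ) ^ 3 := by
      rw [Real.rpow_neg (by positivity), one_div]
      norm_num
    rw [← h]
    exact Real.rpow_le_rpow_of_exponent_le (by linarith) (by norm_num)
  rw [h1, h2]
  refine le_trans ?_ (mul_le_mul_of_nonneg_left h3 (by positivity))
  have h4 : ((3 * d ^ 2 + 2 * d : ℕ) : ℝ) ≤ 5 * (d : ℝ) ^ 2 := by
    push_cast
    nlinarith
  calc _ ≤ 5 * (d : ℝ) ^ 2 * (2 * (1 / ((k : ℝ) * d) ^ 4)) :=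
        mul_le_mul_of_nonneg_right h4 (by positivity)
    _ = 1 / (d : ℝ) ^ 2 * (1 / (k : ℝ) ^ 3) * (10 / k) := by
        field_simp
        norm_num
    _ ≤ 1 / (d : ℝ) ^ 2 * (1 / (k : ℝ) ^ 3) * 1 := by
        gcongr
        rwa [div_le_one (by positivity)]
    _ = _ := mul_one _

theorem SalesData.IsExploration.exists_good_event {r d : ℕ} {ι Ω : Type*} [MeasurableSpace Ω]
    [Countable ι] {P : Measure Ω} [IsProbabilityMeasure P] {W L₀ cmin : ℝ} {φ : Vec r → Vec d}
    {D : Measure (Vec r)} {ν₀ : Param d} {S : SalesData Ω ι r} {N : ℕ} {m : ℝ} {ψ : ℝ → ℝ} {k : ℕ}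
    (hE : S.IsExploration P N m ψ φ D ν₀ k) (hM : IsMarket W L₀ cmin φ D ν₀) (hcmin : 0 < cmin)
    (hψ : StrictMono ψ) (hd : 1 ≤ d) (hk : 10 ≤ k) :
    ∃ G : Set Ω, MeasurableSet G ∧
      1 - (d : ℝ) ^ (-2 : ℝ) * (k : ℝ) ^ (-1.5 : ℝ) ≤ P.real G ∧
      ∀ ω ∈ G, ∀ ν : Param d, S.IsConstrainedMLE φ W k ω ν →
        ‖(ν - ν₀).1‖ ^ 2 + ‖(ν - ν₀).2‖ ^ 2 ≤
          (16 * (1 + 4 * curvature W N * W) / (curvature W N * cmin)) ^ 2 *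
            (64 * (Real.log ((k : ℝ) * d) / k)) := by
  have hkd : 0 < k * d := by positivity
  have hd0 : (0 : ℝ) < d := by exact_mod_cast hd
  have hk0 : (0 : ℝ) < k := by exact_mod_cast (by omega : 0 < k)
  have hn : (0 : ℝ) < (k : ℝ) * d := by positivity
  have hcard : Fintype.card (explorationPeriods d k) = k * d := by
    rw [Fintype.card_coe, card_explorationPeriods]
  have hι : Nonempty ι := by
    have hT : Nonempty (explorationPeriods d k) := by
      rw [← Fintype.card_pos_iff, hcard]
      exact hkd
    have hΩ : Nonempty Ω := nonempty_of_isProbabilityMeasure P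
    obtain ⟨t⟩ := hT
    obtain ⟨ω⟩ := hΩ
    exact ⟨(hE.consideration_nonempty t t.2 ω).choose⟩
  have hlog : 0 ≤ Real.log ((k : ℝ) * d) := by
    refine Real.log_nonneg ?_
    exact_mod_cast hkd
  -- The constant 32 makes the Hoeffding exponent kdε²/8 equal to 4 log(kd), and 2dε² equal to 64
  -- log(kd)/k.
  set ε := Real.sqrt (32 * (Real.log ((k : ℝ) * d) / ((k : ℝ) * d))) with hεdef
  have hε : 0 ≤ ε := Real.sqrt_nonneg _
  have hε2 : ε ^ 2 = 32 * (Real.log ((k : ℝ) * d) / ((k : ℝ) * d)) :=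
    Real.sq_sqrt (by positivity)
  let x : explorationPeriods d k → Ω → Vec d := fun t ω =>
    φ (S.feature t (pick (S.consideration t ω)) ω)
  let p : explorationPeriods d k → Ω → ℝ := fun t ω => S.price t (pick (S.consideration t ω)) ω
  let s : Param d → Ω → ℝ := fun μ ω => ∑ t : explorationPeriods d k, score (S.options t ω)
    (S.baseUtility φ ν₀ t ω) (S.shock t · ω) (S.baseUtility φ μ t ω)
  let dev : (Fin d × Fin d) ⊕ (Fin d × Fin d) ⊕ (Fin d × Fin d) ⊕ Fin d ⊕ Fin d → Ω → ℝ :=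
    Sum.elim (fun a ω => ∑ t, (x t ω a.1 * x t ω a.2 - secondMoment φ D a.1 a.2)) <|
    Sum.elim (fun a ω => ∑ t, x t ω a.1 * x t ω a.2 * (p t ω - 1 / 2)) <|
    Sum.elim (fun a ω => ∑ t, x t ω a.1 * x t ω a.2 * (p t ω ^ 2 - 1 / 3)) <|
    Sum.elim (fun j => s (EuclideanSpace.single j 1, 0)) (fun j => s (0, EuclideanSpace.single j 1))
  have hdev : ∀ i, P {ω | ((k * d : ℕ) : ℝ) * ε ≤ |dev i ω|} ≤
      ENNReal.ofReal (2 * Real.exp (-(4 * Real.log ((k : ℝ) * d)))) := by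
    have hexp : ((k * d : ℕ) : ℝ) * ε ^ 2 / 8 = 4 * Real.log ((k : ℝ) * d) := by
      rw [hε2]
      push_cast
      field_simp
      ring
    rw [← hexp, ← hcard]
    rintro (a | a | a | j | j)
    · exact hE.measure_feature_deviation_le hM a.1 a.2 hε
    · exact hE.measure_price_deviation_le hM a.1 a.2 (g := fun p => p - 1 / 2) (by fun_prop)
        (fun p hp => abs_le.2 ⟨by linarith [hp.1], by linarith [hp.2]⟩) integral_price_sub_half hε
    · exact hE.measure_price_deviation_le hM a.1 a.2 (g := fun p => p ^ 2 - 1 / 3) (by fun_prop)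
        (fun p hp => abs_le.2 ⟨by linarith [sq_nonneg p], by nlinarith [hp.1, hp.2]⟩)
        integral_price_sq_sub_third hε
    · exact hE.measure_score_deviation_le hM (l1Norm_single_fst j).le hε
    · exact hE.measure_score_deviation_le hM (l1Norm_single_snd j).le hε
  obtain ⟨G, hGm, hGP, hG⟩ := exists_measurableSet_of_measure_le (by positivity) hdev
    (((hE.ae_feature_bound hM).and hE.ae_price_mem).and (hE.ae_isStrictBest_choice hM hψ))
  refine ⟨G, hGm, le_trans ?_ hGP, fun ω hω ν hν => ?_⟩
  · refine sub_le_sub_left (le_trans (le_of_eq ?_) (union_bound_le hd hk)) 1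
    simp only [Fintype.card_sum, Fintype.card_prod, Fintype.card_fin]
    congr 2
    ring
  · obtain ⟨⟨⟨hx, hp⟩, hbest⟩, hω'⟩ := hG ω hω
    have hle : ∀ i, |dev i ω| ≤ ((k * d : ℕ) : ℝ) * ε := fun i => (not_le.1 (hω' i)).le
    have hb := SalesData.IsConstrainedMLE.basic_inequality (K := ((k * d : ℕ) : ℝ) * ε) hkd hν
      hM.param_bound (by positivity) hM.nondegenerate
      (fun t => hE.consideration_nonempty t t.2 ω) (fun t => hE.consideration_card t t.2 ω) hx hp
      hbest (fun j l => hle (.inl (j, l))) (fun j l => hle (.inr (.inl (j, l))))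
      (fun j l => hle (.inr (.inr (.inl (j, l))))) (fun j => hle (.inr (.inr (.inr (.inl j)))))
      (fun j => hle (.inr (.inr (.inr (.inr j)))))
    have hW : 0 ≤ W := (l1Norm_nonneg ν₀).trans hM.param_bound
    have hA : l1Norm (ν - ν₀) ≤ 2 * W := by
      have := l1Norm_sub_le ν ν₀
      linarith [hν.1, hM.param_bound]
    refine (sq_error_le_of_basic_inequality (curvature_pos hW N) hcmin
      (by exact_mod_cast hkd : (0 : ℝ) < ((k * d : ℕ) : ℝ)) hW hε (l1Norm_nonneg _) (by positivity)
      hA (l1Norm_sq_le _) hb).trans (le_of_eq ?_)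
    rw [hε2]
    congr 1
    field_simp
    ring

end

end MNLPricing

/-! ### Choice of the constants and degenerate cases -/

theorem mainTheorem2 (W L₀ cmin : ℝ) (N : ℕ) (hL₀ : 0 < L₀) (hcmin : 0 < cmin) :
    ∃ c₀ c₁ c₂ : ℝ, 0 < c₀ ∧ 0 < c₁ ∧ 0 < c₂ ∧
      ∀ (r d k : ℕ) (m : ℝ) (ψ : ℝ → ℝ) (φ : MNLPricing.Vec r → MNLPricing.Vec d)
        (D : Measure (MNLPricing.Vec r)) (θ₀ γ₀ : MNLPricing.Vec d)
        (Ω : Type*) [MeasurableSpace Ω] (P : Measure Ω) [IsProbabilityMeasure P]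
        (ι : Type*) [Countable ι] (S : MNLPricing.SalesData Ω ι r),
        StrictMono ψ →
        MNLPricing.IsMarket W L₀ cmin φ D (θ₀, γ₀) →
        S.IsExploration P N m ψ φ D (θ₀, γ₀) k →
        c₀ * (d : ℝ) ≤ (k : ℝ) →
        ∃ G : Set Ω, MeasurableSet G ∧
          1 - (d : ℝ) ^ (-2 : ℝ) * (k : ℝ) ^ (-1.5 : ℝ)
              - 2 * Real.exp (-c₂ * ((k : ℝ) * d)) ≤ P.real G ∧
          ∀ ω ∈ G, ∀ θ γ : MNLPricing.Vec d, S.IsConstrainedMLE φ W k ω (θ, γ) →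
            ‖θ - θ₀‖ ^ 2 + ‖γ - γ₀‖ ^ 2 ≤ c₁ * (Real.log ((k : ℝ) * d) / k) := by
  -- For negative W no parameter satisfies ‖ν₀‖₁ ≤ W, and any constants will do.
  by_cases hW : 0 ≤ W
  swap
  · refine ⟨1, 1, 1, one_pos, one_pos, one_pos, ?_⟩
    intro r d k m ψ φ D θ₀ γ₀ Ω _ P _ ι _ S _ hM
    exact absurd ((MNLPricing.l1Norm_nonneg _).trans hM.param_bound) hW
  have hc := MNLPricing.curvature_pos hW N
  -- The value 10 gives k ≥ 10 as soon as d ≥ 1, as the union bound requires. Any positive c₂ works,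
  -- since the good event already has probability at least 1 - d⁻²k^(-1.5).
  refine ⟨10, (16 * (1 + 4 * MNLPricing.curvature W N * W) /
    (MNLPricing.curvature W N * cmin)) ^ 2 * 64, 1, by norm_num, by positivity, one_pos, ?_⟩
  intro r d k m ψ φ D θ₀ γ₀ Ω _ P _ ι _ S hψ hM hE hk
  -- For d = 0 the parameter space is a point and the error vanishes; of the power of zero only
  -- nonnegativity is needed.
  rcases Nat.eq_zero_or_pos d with rfl | hd
  · refine ⟨Set.univ, MeasurableSet.univ, ?_, fun ω _ θ γ _ => ?_⟩
    · rw [probReal_univ]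
      have h1 : (0 : ℝ) ≤ ((0 : ℕ) : ℝ) ^ (-2 : ℝ) * (k : ℝ) ^ (-1.5 : ℝ) := by positivity
      exact (sub_le_self _ (by positivity)).trans (sub_le_self _ h1)
    · simp [Subsingleton.elim θ θ₀, Subsingleton.elim γ γ₀]
  · have hk10 : 10 ≤ k := by
      have hd1 : (1 : ℝ) ≤ d := by exact_mod_cast hd
      have : (10 : ℝ) ≤ k := by linarith
      exact_mod_cast this
    obtain ⟨G, hGm, hGP, hG⟩ := hE.exists_good_event hM hcmin hψ hd hk10
    refine ⟨G, hGm, ?_, fun ω hω θ γ hMLE => ?_⟩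
    · linarith [Real.exp_pos (-1 * ((k : ℝ) * d))]
    · rw [mul_assoc]
      exact hG ω hω (θ, γ) hMLE
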